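/- Let $K$ be any field (for example $\mathbb C$, or a field of rational functions in $a,q$), let $a,q\in K$ with $q\neq 0$, and let $n\ge 0$ be an integer. Write $(x;p)_m=\prod_{j=0}^{m-1}(1-xp^j)$. For positive integers $d,e,k$ put $$\alpha^{(d,e,k)}_{s}(a^e,0,q^e)=\frac{(-1)^r a^{(k-d)r}q^{(dk-d^2+\frac d2)r^2-\frac d2 r}\,(aq^{2d};q^{2d})_r\,(a;q^d)_r}{(a;q^{2d})_r\,(q^d;q^d)_r}\quad\text{if } s=dr,$$ and $\alpha^{(d,e,k)}_s(a^e,0,q^e)=0$ if $d\nmid s$ (for $a=1$, $r\ge1$ the quotient of $q$-factorials is read after cancelling the common factor $1-a$, i.e. as $1+q^{dr}$), and let $$\beta^{(d,e,k)}_n(a^e,0,q^e)=\sum_{s=0}^n\frac{\alpha^{(d,e,k)}_s(a^e,0,q^e)}{(q^e;q^e)_{n-s}\,(a^eq^e;q^e)_{n+s}}$$ be the sequence forming a Bailey pair with it relative to $(a^e,q^e)$. Then each of the following holds whenever the left side is defined, i.e. $(q^e;q^e)_n\neq0$ and $(a^eq^e;q^e)_{2n}\ne0$ for the value of $e$ concerned.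 In each sum $r\ge0$ runs over $r\le n$, except in the last one, where $2r\le n$ (that is, $1/(p;p)_m=0$ for $m<0$). In the formulas for $(1,4,2)$ and $(1,4,3)$, $i$ is any element of $K$ with $i^2=-1$; in that for $(1,3,1)$, $a\ne0$; in those for $(3,2,7)$ and $(3,3,7)$, $a\neq1$. $$\beta^{(1,2,3)}_n(a^2,0,q^2)=\frac1{(-q;q)_n}\sum_{r}\frac{a^rq^{r^2}}{(q;q)_r(q;q)_{n-r}(-aq;q)_{n+r}}$$ $$\beta^{(1,2,4)}_n(a^2,0,q^2)=\sum_{r}\frac{a^{2r}q^{2r^2}}{(-aq;q)_{2r}(q^2;q^2)_r(q^2;q^2)_{n-r}}$$ $$\beta^{(1,3,1)}_n(a^3,0,q^3)=\frac{(-1)^na^{-n}q^{-\binom{n+1}2}(q;q)_n}{(q^3;q^3)_n(aq;q)_{2n}}\sum_r\frac{(-1)^rq^{\binom{r+1}2-nr}(aq;q)_{n+r}(aq;q)_{2n+r}}{(a^3q^3;q^3)_{n+r}(q;q)_r(q;q)_{n-r}}$$ $$\beta^{(1,3,3)}_n(a^3,0,q^3)=\frac{(q;q)_n}{(aq;q)_{2n}(q^3;q^3)_n}\sum_r\frac{a^rq^{r^2}(aq;q)_{2n+r}(aq;q)_{n+r}}{(a^3q^3;q^3)_{n+r}(q;q)_r(q;q)_{n-r}}$$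 $$\beta^{(1,3,5)}_n(a^3,0,q^3)=\sum_r\frac{a^{3r}q^{3r^2}(aq;q)_{3r}}{(a^3q^3;q^3)_{2r}(q^3;q^3)_r(q^3;q^3)_{n-r}}$$ $$\beta^{(1,4,1)}_n(a^4,0,q^4)=\frac{(-1)^nq^{2n^2}}{(-a^2q^2;q^2)_{2n}}\sum_r\frac{q^{3r^2-4nr}}{(q^2;q^2)_r(-aq;q)_{2r}(q^4;q^4)_{n-r}}$$ $$\beta^{(1,4,2)}_n(a^4,0,q^4)=\frac{i^nq^{n^2}(iq;q)_n(q;q)_n}{(q^4;q^4)_n(iaq;q)_{2n}^2}\sum_r\frac{(-i)^rq^{r^2-2nr}(iaq;q)_{2n+r}}{(q;q)_r(-iaq;q)_{n+r}(-aq;q)_{n+r}(q;q)_{n-r}(iq;q)_{n-r}}$$ $$\beta^{(1,4,3)}_n(a^4,0,q^4)=\frac{(iq;q)_n(q;q)_n}{(q^4;q^4)_n(iaq;q)_{2n}^2}\sum_r\frac{a^rq^{r^2}(iaq;q)_{2n+r}}{(q;q)_r(-iaq;q)_{n+r}(-aq;q)_{n+r}(q;q)_{n-r}(iq;q)_{n-r}}$$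 $$\beta^{(1,4,4)}_n(a^4,0,q^4)=\frac1{(-a^2q^2;q^2)_{2n}}\sum_r\frac{a^{2r}q^{2r^2}}{(q^2;q^2)_r(-aq;q)_{2r}(q^4;q^4)_{n-r}}$$ $$\beta^{(1,6,3)}_n(a^6,0,q^6)=\frac1{(a^6q^6;q^6)_{2n}}\sum_r\frac{(-1)^ra^{2r}q^{3r^2}(a^2q^2;q^2)_{3n-r}}{(q^2;q^2)_r(-aq;q)_{2r}(q^6;q^6)_{n-r}}$$ $$\beta^{(1,6,4)}_n(a^6,0,q^6)=\frac1{(a^6q^6;q^6)_{2n}}\sum_r\frac{a^{2r}q^{2r^2}(a^2q^2;q^2)_{3n-r}}{(q^2;q^2)_r(-aq;q)_{2r}(q^6;q^6)_{n-r}}$$ $$\beta^{(2,1,5)}_n(a,0,q)=\sum_r\frac{a^rq^{r^2}}{(q;q)_r(aq;q^2)_r(q;q)_{n-r}}$$ $$\beta^{(2,2,2)}_n(a^2,0,q^2)=\frac{(-1)^nq^{n^2}}{(-aq;q)_{2n}}\sum_r\frac{(-1)^rq^{\frac32r^2-\frac12r-2nr}}{(aq;q^2)_r(q;q)_r(q^2;q^2)_{n-r}}$$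 $$\beta^{(2,2,3)}_n(a^2,0,q^2)=\frac{(aq^2;q^2)_n}{(a^2q^2;q^2)_{2n}}\sum_r\frac{a^rq^{2nr}}{(q^2;q^2)_r(q^2;q^2)_{n-r}}$$ $$\beta^{(2,2,4)}_n(a^2,0,q^2)=\frac{(aq^2;q^2)_n}{(a^2q^2;q^2)_{2n}}\sum_r\frac{a^rq^{2r^2}}{(q^2;q^2)_r(q^2;q^2)_{n-r}}$$ $$\beta^{(2,2,5)}_n(a^2,0,q^2)=\frac1{(-aq;q)_{2n}}\sum_r\frac{a^rq^{r^2}}{(q;q)_r(aq;q^2)_r(q^2;q^2)_{n-r}}$$ $$\beta^{(3,2,7)}_n(a^2,0,q^2)=\frac1{(-aq;q)_{2n}}\sum_r\frac{a^rq^{r^2}(a;q^3)_r}{(a;q)_{2r}(q;q)_r(q^2;q^2)_{n-r}}$$ $$\beta^{(3,3,7)}_n(a^3,0,q^3)=\frac1{(a^3q^3;q^3)_{2n}}\sum_r\frac{a^rq^{r^2}(a;q^3)_r(aq;q)_{3n-r}}{(q;q)_r(a;q)_{2r}(q^3;q^3)_{n-r}}$$ $$\beta^{(4,1,7)}_n(a,0,q)=\frac1{(aq;q^2)_n}\sum_{r}\frac{a^rq^{2r^2}}{(q^2;q^2)_r(aq^2;q^4)_r(q;q)_{n-2r}}$$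 -/

import Mathlib

open Finset

noncomputable section

/-- The rising `q`-factorial `(a;q)_n = ∏_{j=0}^{n-1} (1 - a q^j)`. -/
def qPoch {K : Type*} [Field K] (a q : K) (n : ℕ) : K :=
  ∏ j ∈ range n, (1 - a * q ^ j)

/-- The sequence `β` belonging to `α` relative to `(a,q)` in a Bailey pair:
`β_n = ∑_{s=0}^n α_s / ((q;q)_{n-s} (aq;q)_{n+s})`. -/
def baileyBeta {K : Type*} [Field K] (a q : K) (α : ℕ → K) (n : ℕ) : K :=
  ∑ s ∈ range (n + 1), α s / (qPoch q q (n - s) * qPoch (a * q) q (n + s))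

/-- `(α, β)` is a Bailey pair relative to `(a,q)`. -/
def IsBaileyPair {K : Type*} [Field K] (a q : K) (α β : ℕ → K) : Prop :=
  ∀ n, β n = baileyBeta a q α n

open Classical in
/-- The very-well-poised quotient `(aQ²;Q²)_r (a;Q)_r / ((a;Q²)_r (Q;Q)_r)`.
For `a = 1` and `r ≥ 1` the quotient as written is `0/0`; as usual it is then read after cancelling
the common factor `1 - a`, which gives `(1 - Q^{2r}) (Q;Q)_{r-1} / (Q;Q)_r = 1 + Q^r`
(see `vwpQuotient_eq`). -/
def vwpQuotient {K : Type*} [Field K] (a Q : K) (r : ℕ) : K :=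
  if a = 1 ∧ r ≠ 0 then 1 + Q ^ r
  else qPoch (a * Q ^ 2) (Q ^ 2) r * qPoch a Q r / (qPoch a (Q ^ 2) r * qPoch Q Q r)

/-- The `α`-sequence `α^{(d,e,k)}_n(a^e,0,q^e)` of the standard multiparameter Bailey pair, as a
function of `a` and `q`; its value does not involve `e`. For `n = d r` it is
`(-1)^r a^{(k-d)r} q^{(dk-d²+d/2)r² - (d/2)r}` times
`(aq^{2d};q^{2d})_r (a;q^d)_r / ((a;q^{2d})_r (q^d;q^d)_r)`, and otherwise it is `0`.
The exponent of `q` is written as the integer `d(k-d)r² + d·r(r-1)/2`. -/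
def smpAlpha {K : Type*} [Field K] (d _e k : ℕ) (a q : K) (n : ℕ) : K :=
  if d ∣ n then
    (-1) ^ (n / d) * a ^ (((k : ℤ) - d) * (n / d : ℕ))
      * q ^ ((d : ℤ) * ((k : ℤ) - d) * ((n / d : ℕ) : ℤ) ^ 2 + (d : ℤ) * ((n / d).choose 2 : ℕ))
      * vwpQuotient a (q ^ d) (n / d)
  else 0

/-- `β^{(d,e,k)}_n(a^e,0,q^e)`, as a function of `a` and `q`: the sequence that forms a Bailey pair
relative to `(a^e,q^e)` with `α^{(d,e,k)}_n(a^e,0,q^e)`. -/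
def smpBeta {K : Type*} [Field K] (d e k : ℕ) (a q : K) (n : ℕ) : K :=
  baileyBeta (a ^ e) (q ^ e) (smpAlpha d e k a q) n

/-- The denominators `(q^e;q^e)_{n-s}` and `(a^e q^e;q^e)_{n+s}`, `0 ≤ s ≤ n`, in the definition of
`β^{(d,e,k)}_n(a^e,0,q^e)` do not vanish. -/
def BetaDefined {K : Type*} [Field K] (e : ℕ) (a q : K) (n : ℕ) : Prop :=
  qPoch (q ^ e) (q ^ e) n ≠ 0 ∧ qPoch (a ^ e * q ^ e) (q ^ e) (2 * n) ≠ 0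

theorem smpBeta_isBaileyPair {K : Type*} [Field K] (d e k : ℕ) (a q : K) :
    IsBaileyPair (a ^ e) (q ^ e) (smpAlpha d e k a q) (smpBeta d e k a q) :=
  fun _ => rfl

theorem qPoch_succ {K : Type*} [Field K] (a q : K) (n : ℕ) :
    qPoch a q (n + 1) = qPoch a q n * (1 - a * q ^ n) := by
  simp [qPoch, prod_range_succ]

theorem qPoch_succ' {K : Type*} [Field K] (a q : K) (n : ℕ) :
    qPoch a q (n + 1) = (1 - a) * qPoch (a * q) q n := by
  simp only [qPoch, prod_range_succ']
  rw [mul_comm]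
  simp [pow_succ', mul_assoc]

/-- For every `a`, including `a = 1`, the very-well-poised quotient with `r ≥ 1` equals the quotient
in which the common factor `1 - a` has been cancelled. -/
theorem vwpQuotient_eq {K : Type*} [Field K] (a Q : K) (r : ℕ)
    (ha : qPoch (a * Q ^ 2) (Q ^ 2) r ≠ 0) (hQ : qPoch Q Q (r + 1) ≠ 0) :
    vwpQuotient a Q (r + 1)
      = (1 - a * Q ^ (2 * (r + 1))) * qPoch (a * Q) Q r / qPoch Q Q (r + 1) := by
  unfold vwpQuotient
  by_cases h : a = 1
  · subst h
    rw [if_pos ⟨rfl, Nat.succ_ne_zero r⟩, eq_div_iff hQ, qPoch_succ]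
    simp only [one_mul]
    ring
  · rw [if_neg (fun h' => h h'.1), qPoch_succ' a Q, qPoch_succ' a (Q ^ 2),
      qPoch_succ (a * Q ^ 2) (Q ^ 2)]
    have h1 : (1 : K) - a ≠ 0 := sub_ne_zero.mpr (Ne.symm h)
    field_simp
    ring

end

/-! In the classical Bailey lemma the parameters ρ₁, ρ₂ enter only symmetrically. They can therefore
be replaced by the coefficients of a quadratic Y - Zt + aXt², which up to scale is (1-ρ₁t)(1-ρ₂t).
In this homogeneous form the roots need not lie in K, and the limits ρ → 0, ∞ are mere
specialisations of X, Y, Z. `bailey_lemma` follows from the q-Saalschütz sum `qSaalschutz_sum`. The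
basic input is the unit pair, whose β is 1 at n = 0 and 0 elsewhere (`baileyBeta_unitAlpha`).

The decisive specialisation is X = 1, Y = azq^{2n}, Z = ayq^n. Let P_m = ∏_{i=1}^m (1 - yq^i +
zq^{2i}), and let R_m be the same product with (ay, a²z) for (y, z). Then α_s acquires the weight
a^s q^{s²}, and (q;q)_{n-s}(aq;q)_{n+s} is multiplied by P_{n-s}R_{n+s} (`sum_change_of_base`). As
1-x² = (1-x)(1+x) and 1-x³ = (1-x)(1+x+x²), this changes the base from q to q² or q³; y = z = 0 is
the ordinary chain step. A dual with linear factors leaves α unweighted. Composing such steps from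
the unit pair, with the power of a in α counting the weights, gives (1,2,4), (1,3,5), (1,4,1),
(1,4,4), (1,6,3) and (1,6,4).

For (1,2,3), (1,3,1), (1,3,3), (1,4,2) and (1,4,3) the factors P_{n-s}R_{n+s} are first absorbed
into α with n fixed (`poisedAlpha`). The β of this pair is a terminating ₆φ₅, and one more step,
taken at index n itself, produces the single sum, as in Watson's transformation.

For d = 2 and 4, `baileyBeta_double` and its dual pass from base q² to q while spreading α over the
even integers; their kernels are finite sums determined by a recurrence. In (2,2,3) and (2,2,4) this
leaves a double sum, which the q-binomial theorem collapses. For d = 3 the pair (3,1,4) satisfies a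
first-order recurrence in n, proved by telescoping (`tripling_partial_sum`), and a change of base
then gives (3,2,7) and (3,3,7). -/

noncomputable section

/-! ### The homogeneous Bailey lemma and the unit Bailey pair. -/

section Basic

variable {K : Type*} [Field K]

@[simp] theorem qPoch_zero (a q : K) : qPoch a q 0 = 1 := by simp [qPoch]

theorem qPoch_add (a q : K) (m n : ℕ) :
    qPoch a q (m + n) = qPoch a q m * qPoch (a * q ^ m) q n := by
  simp only [qPoch, prod_range_add, pow_add, mul_assoc]

theorem qPoch_ne_zero_iff {a q : K} {n : ℕ} :
    qPoch a q n ≠ 0 ↔ ∀ j < n, 1 - a * q ^ j ≠ 0 := by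
  simp [qPoch, prod_ne_zero_iff]

theorem qPoch_ne_zero_of_le {a q : K} {m n : ℕ} (h : qPoch a q n ≠ 0) (hmn : m ≤ n) :
    qPoch a q m ≠ 0 :=
  qPoch_ne_zero_iff.2 fun j hj => qPoch_ne_zero_iff.1 h j (hj.trans_le hmn)

theorem qPoch_shift_ne_zero {a q : K} {m n k : ℕ} (h : qPoch a q k ≠ 0) (hmn : m + n ≤ k) :
    qPoch (a * q ^ m) q n ≠ 0 := by
  have h1 := qPoch_ne_zero_of_le h hmn
  rw [qPoch_add] at h1
  exact right_ne_zero_of_mul h1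

/-- If `y ^ e = x`, then every factor of `(y;q)_n` divides the matching factor of `(x;q^e)_n`. -/
theorem qPoch_ne_zero_of_pow {x y q : K} {e n : ℕ} (h : qPoch x (q ^ e) n ≠ 0) (hy : y ^ e = x) :
    qPoch y q n ≠ 0 := by
  rw [qPoch_ne_zero_iff] at h ⊢
  intro j hj h0
  apply h j hj
  have h1 : y * q ^ j = 1 := (sub_eq_zero.1 h0).symm
  rw [← hy, ← pow_mul, mul_comm e j, pow_mul, ← mul_pow, h1, one_pow, sub_self]

/-- `∏_{j<n} (x - y q^j + z q^{2j})`. -/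
def quadProd (x y z q : K) (n : ℕ) : K :=
  ∏ j ∈ range n, (x - y * q ^ j + z * q ^ (2 * j))

@[simp] theorem quadProd_zero (x y z q : K) : quadProd x y z q 0 = 1 := by simp [quadProd]

theorem quadProd_succ (x y z q : K) (n : ℕ) :
    quadProd x y z q (n + 1) = quadProd x y z q n * (x - y * q ^ n + z * q ^ (2 * n)) := by
  simp [quadProd, prod_range_succ]

theorem quadProd_add (x y z q : K) (m n : ℕ) :
    quadProd x y z q (m + n) = quadProd x y z q m *
      quadProd x (y * q ^ m) (z * q ^ (2 * m)) q n := by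
  simp only [quadProd, prod_range_add, mul_add, pow_add, mul_assoc]

/-- The homogeneous `q`-Pfaff--Saalschütz sum. -/
theorem qSaalschutz_sum (a q X Y Z : K) (N : ℕ) (hq : qPoch q q N ≠ 0)
    (ha : qPoch (a * q) q N ≠ 0) :
    ∑ m ∈ range (N + 1), q ^ m * quadProd Y Z (a * X) q m * quadProd X (Y * q) 0 q (N - m) /
        (qPoch q q (N - m) * qPoch q q m * qPoch (a * q) q m) =
      quadProd X (Z * q) (a * Y * q ^ 2) q N / (qPoch q q N * qPoch (a * q) q N) := by
  induction N with
  | zero => simp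
  | succ N ih =>
    have hq' := qPoch_ne_zero_of_le hq N.le_succ
    have ha' := qPoch_ne_zero_of_le ha N.le_succ
    have ih' := ih hq' ha'
    have e1 : (1 - q * q ^ N) ≠ 0 := qPoch_ne_zero_iff.1 hq N N.lt_succ_self
    have e2 : (1 - a * q * q ^ N) ≠ 0 := qPoch_ne_zero_iff.1 ha N N.lt_succ_self
    rw [quadProd_succ, qPoch_succ q q N, qPoch_succ (a * q) q N, eq_div_iff (by positivity)]
    have key : quadProd X (Z * q) (a * Y * q ^ 2) q N
        * (X - Z * q * q ^ N + a * Y * q ^ 2 * q ^ (2 * N)) =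
        (∑ m ∈ range (N + 1), q ^ m * quadProd Y Z (a * X) q m * quadProd X (Y * q) 0 q (N - m) /
        (qPoch q q (N - m) * qPoch q q m * qPoch (a * q) q m)) *
        ((qPoch q q N * qPoch (a * q) q N) *
          (X - Z * q * q ^ N + a * Y * q ^ 2 * q ^ (2 * N))) := by
      rw [ih', ← mul_assoc, div_mul_cancel₀ _ (mul_ne_zero hq' ha')]
    rw [key]
    set u : ℕ → K := fun m =>
      q ^ m * quadProd Y Z (a * X) q m * quadProd X (Y * q) 0 q (N + 1 - m) /
        (qPoch q q (N + 1 - m) * qPoch q q m * qPoch (a * q) q m) with hu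
    set b : ℕ → K := fun m =>
      q ^ m * quadProd Y Z (a * X) q m * quadProd X (Y * q) 0 q (N - m) /
        (qPoch q q (N - m) * qPoch q q m * qPoch (a * q) q m) with hb
    suffices hs : (∑ m ∈ range (N + 1 + 1), u m) * ((1 - q * q ^ N) * (1 - a * q * q ^ N)) =
        (∑ m ∈ range (N + 1), b m) * (X - Z * q * q ^ N + a * Y * q ^ 2 * q ^ (2 * N)) by
      linear_combination (qPoch q q N * qPoch (a * q) q N) * hs
    -- With A = q^m and B = q^{N+1-m}, this is (1-AB)(1-aAB) = B(1-A)(1-aA) + (1-B)(1-aA²B). The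
    -- first part vanishes at m = 0 and the second at m = N+1. So the first part at m+1 pairs with
    -- the second at m, and both are multiples of `b m` whose multipliers add up to the new factor
    -- of the right side.
    have hsplit : ∀ m ∈ range (N + 1 + 1), u m * ((1 - q * q ^ N) * (1 - a * q * q ^ N)) =
        u m * (q ^ (N + 1 - m) * (1 - q ^ m) * (1 - a * q ^ m)) +
          u m * ((1 - q ^ (N + 1 - m)) * (1 - a * q ^ (N + 1 + m))) := by
      intro m hm
      obtain ⟨k, hk⟩ := Nat.exists_eq_add_of_le (Nat.lt_succ_iff.1 (mem_range.1 hm))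
      have h1 : q * q ^ N = q ^ m * q ^ k := by rw [← pow_succ', hk, pow_add]
      have h2 : N + 1 - m = k := by omega
      have h3 : q ^ (N + 1 + m) = q ^ m * q ^ m * q ^ k := by rw [hk]; ring
      rw [h2, h3, mul_assoc a q, h1]
      ring
    rw [sum_mul, sum_congr rfl hsplit, sum_add_distrib, sum_range_succ', sum_range_succ
      (fun m => u m * ((1 - q ^ (N + 1 - m)) * (1 - a * q ^ (N + 1 + m))))]
    simp only [Nat.sub_self, pow_zero, sub_self, mul_zero, zero_mul, add_zero]
    rw [← sum_add_distrib, sum_mul]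
    refine sum_congr rfl fun m hm => ?_
    obtain ⟨k, rfl⟩ := Nat.exists_eq_add_of_le (Nat.lt_succ_iff.1 (mem_range.1 hm))
    have h1 : m + k + 1 - (m + 1) = k := by omega
    have h2 : m + k + 1 - m = k + 1 := by omega
    have h3 : m + k - m = k := by omega
    have f1 := qPoch_ne_zero_of_le hq' (Nat.le_add_right m k)
    have f2 := qPoch_ne_zero_of_le hq' (Nat.le_add_left k m)
    have f3 := qPoch_ne_zero_of_le ha' (Nat.le_add_right m k)
    have f4 : 1 - q * q ^ m ≠ 0 := qPoch_ne_zero_iff.1 hq m (by omega)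
    have f5 : 1 - q * q ^ k ≠ 0 := qPoch_ne_zero_iff.1 hq k (by omega)
    have f6 : 1 - a * q * q ^ m ≠ 0 := qPoch_ne_zero_iff.1 ha m (by omega)
    have g1 : u (m + 1) * (q ^ k * (1 - q ^ (m + 1)) * (1 - a * q ^ (m + 1))) =
        b m * (q * q ^ k * (Y - Z * q ^ m + a * X * q ^ (2 * m))) := by
      simp only [hu, hb, h1, h3, quadProd_succ, qPoch_succ, pow_succ' q m, mul_comm 2 m, pow_mul]
      generalize q ^ m = x at f4 f6 ⊢
      generalize q ^ k = y
      have f8 : 1 - a * (q * x) = 1 - a * q * x := by ring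
      rw [f8]
      generalize 1 - a * q * x = w at f6 ⊢
      field_simp
    have g2 : u m * ((1 - q ^ (k + 1)) * (1 - a * q ^ (m + k + 1 + m))) =
        b m * ((1 - a * q ^ (m + k + 1 + m)) * (X - Y * q * q ^ k)) := by
      simp only [hu, hb, h2, h3, quadProd_succ, qPoch_succ, zero_mul, add_zero, pow_succ' q k]
      generalize 1 - q * q ^ k = w at f5 ⊢
      field_simp
    rw [h1, h2, g1, g2]
    ring

/-- Interchange of summation for connection coefficients between Bailey pairs. -/
theorem sum_mul_baileyBeta (a q : K) (α c κ : ℕ → K) (N : ℕ)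
    (h : ∀ s ≤ N, ∑ m ∈ range (N - s + 1),
      c (s + m) / (qPoch q q m * qPoch (a * q) q (s + m + s)) = κ s) :
    ∑ m ∈ range (N + 1), c m * baileyBeta a q α m = ∑ s ∈ range (N + 1), κ s * α s := by
  simp only [baileyBeta, mul_sum]
  rw [sum_comm' (t' := range (N + 1)) (s' := fun s => Ico s (N + 1))]
  · refine sum_congr rfl fun s hs => ?_
    have hs' : s ≤ N := Nat.lt_succ_iff.1 (mem_range.1 hs)
    rw [sum_Ico_eq_sum_range, ← h s hs', sum_mul]
    rw [show N + 1 - s = N - s + 1 by omega]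
    refine sum_congr rfl fun m _ => ?_
    rw [Nat.add_sub_cancel_left]
    ring
  · intro x y
    simp only [mem_range, mem_Ico]
    omega

/-- The Bailey lemma in homogeneous form. -/
theorem bailey_lemma (a q X Y Z : K) (α : ℕ → K) (n : ℕ) (hq : qPoch q q n ≠ 0)
    (ha : qPoch (a * q) q (2 * n) ≠ 0) :
    ∑ m ∈ range (n + 1), q ^ m * quadProd Y Z (a * X) q m * quadProd X (Y * q) 0 q (n - m) /
        qPoch q q (n - m) * baileyBeta a q α m =
      ∑ s ∈ range (n + 1), q ^ s * quadProd Y Z (a * X) q s *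
        quadProd X (Z * q ^ (s + 1)) (a * Y * q ^ (2 * s + 2)) q (n - s) /
          (qPoch q q (n - s) * qPoch (a * q) q (n + s)) * α s := by
  apply sum_mul_baileyBeta
  intro s hs
  obtain ⟨N, rfl⟩ := Nat.exists_eq_add_of_le hs
  have h0 : a * q * q ^ (2 * s) = a * q ^ (2 * s) * q := by ring
  have ha1 : qPoch (a * q ^ (2 * s) * q) q N ≠ 0 := by
    rw [← h0]
    exact qPoch_shift_ne_zero ha (by omega)
  have ha2 : qPoch (a * q) q (2 * s) ≠ 0 := qPoch_ne_zero_of_le ha (by omega)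
  -- For fixed s the inner sum is again a Saalschütz sum, with a replaced by aq^{2s} and Z by Zq^s.
  have key := qSaalschutz_sum (a * q ^ (2 * s)) q X Y (Z * q ^ s) N
    (qPoch_ne_zero_of_le hq (by omega)) ha1
  rw [Nat.add_sub_cancel_left, show s + N + s = 2 * s + N by ring, qPoch_add (a * q) q (2 * s) N,
    h0, show a * Y * q ^ (2 * s + 2) = a * q ^ (2 * s) * Y * q ^ 2 by ring,
    show Z * q ^ (s + 1) = Z * q ^ s * q by ring]
  have : q ^ s * quadProd Y Z (a * X) q s * quadProd X (Z * q ^ s * q) (a * q ^ (2 * s) * Y * q ^ 2)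
      q N / (qPoch q q N * (qPoch (a * q) q (2 * s) * qPoch (a * q ^ (2 * s) * q) q N)) =
      q ^ s * quadProd Y Z (a * X) q s / qPoch (a * q) q (2 * s) *
      (quadProd X (Z * q ^ s * q) (a * q ^ (2 * s) * Y * q ^ 2) q N /
        (qPoch q q N * qPoch (a * q ^ (2 * s) * q) q N)) := by
    rw [div_mul_div_comm]
    congr 1
    ring
  rw [this, ← key, mul_sum]
  refine sum_congr rfl fun m hm => ?_
  rw [show s + N - (s + m) = N - m by omega, show s + m + s = 2 * s + m by ring, qPoch_add,
    quadProd_add, h0, pow_add, show a * X * q ^ (2 * s) = a * q ^ (2 * s) * X by ring]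
  rw [div_div, div_mul_div_comm]
  congr 1 <;> ring

/-- The unit Bailey pair's `α`. -/
def unitAlpha (a q : K) (r : ℕ) : K := (-1) ^ r * q ^ r.choose 2 * vwpQuotient a q r

theorem unitAlpha_zero (a q : K) : unitAlpha a q 0 = 1 := by simp [unitAlpha, vwpQuotient]

theorem unitAlpha_succ (a q : K) (r : ℕ) (ha : qPoch (a * q) q (2 * r) ≠ 0)
    (hq : qPoch q q (r + 1) ≠ 0) :
    unitAlpha a q (r + 1) = (-1) ^ (r + 1) * q ^ (r + 1).choose 2 *
      ((1 - a * q ^ (2 * (r + 1))) * qPoch (a * q) q r / qPoch q q (r + 1)) := by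
  rw [unitAlpha, vwpQuotient_eq a q r _ hq]
  rw [qPoch_ne_zero_iff] at ha ⊢
  intro j hj
  have := ha (2 * j + 1) (by omega)
  contrapose! this
  rw [← this]
  ring

/-- The sum is indefinitely summable: its partial sums have a closed form, checked by adding one
term. The last term of the full sum then cancels the partial sum at M = n, so the unit pair has β =
0 at n+1. -/
theorem unitAlpha_partial_sum (a q : K) (n : ℕ) (hq : qPoch q q (n + 1) ≠ 0)
    (ha : qPoch (a * q) q (2 * (n + 1)) ≠ 0) (M : ℕ) (hM : M ≤ n) :
    ∑ r ∈ range (M + 1), unitAlpha a q r / (qPoch q q (n + 1 - r) * qPoch (a * q) q (n + 1 + r)) =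
      (-1) ^ M * q ^ (M + 1).choose 2 * qPoch (a * q) q M /
        (qPoch q q M * qPoch q q (n - M) * qPoch (a * q) q (n + 1 + M) * (1 - q ^ (n + 1))) := by
  have e0 : 1 - q ^ (n + 1) ≠ 0 := by
    rw [pow_succ']; exact qPoch_ne_zero_iff.1 hq n n.lt_succ_self
  induction M with
  | zero =>
    simp only [zero_add, sum_range_one, unitAlpha_zero, Nat.sub_zero, add_zero, qPoch_zero,
      pow_zero, one_mul, Nat.choose]
    rw [qPoch_succ, ← pow_succ']
    congr 1; ring
  | succ M ih =>
    rw [sum_range_succ, ih (by omega), unitAlpha_succ a q M (qPoch_ne_zero_of_le ha (by omega))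
      (qPoch_ne_zero_of_le hq (by omega))]
    obtain ⟨k, rfl⟩ := Nat.exists_eq_add_of_le hM
    have h1 : M + 1 + k + 1 - (M + 1) = k + 1 := by omega
    have h2 : M + 1 + k - M = k + 1 := by omega
    have h3 : M + 1 + k - (M + 1) = k := by omega
    rw [h1, h2, h3, show M + 1 + k + 1 + (M + 1) = M + 1 + k + 1 + M + 1 by ring,
      qPoch_succ (a * q) q (M + 1 + k + 1 + M), qPoch_succ q q M, qPoch_succ q q k,
      qPoch_succ (a * q) q M, Nat.choose_succ_succ' (M + 1) 1, pow_add q ((M + 1).choose 1)]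
    have f1 : qPoch q q M ≠ 0 := qPoch_ne_zero_of_le hq (by omega)
    have f2 : qPoch q q k ≠ 0 := qPoch_ne_zero_of_le hq (by omega)
    have f3 : qPoch (a * q) q (M + 1 + k + 1 + M) ≠ 0 := qPoch_ne_zero_of_le ha (by omega)
    have f4 : 1 - q * q ^ M ≠ 0 := qPoch_ne_zero_iff.1 hq M (by omega)
    have f5 : 1 - q * q ^ k ≠ 0 := qPoch_ne_zero_iff.1 hq k (by omega)
    have f6 : 1 - a * q * q ^ (M + 1 + k + 1 + M) ≠ 0 := qPoch_ne_zero_iff.1 ha _ (by omega)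
    rw [Nat.choose_one_right]
    generalize qPoch (a * q) q (M + 1 + k + 1 + M) = A at *
    generalize qPoch (a * q) q M = B
    have g1 : a * q * q ^ (M + 1 + k + 1 + M) = a * q ^ 3 * (q ^ M) ^ 2 * q ^ k := by ring
    have g2 : q ^ (M + 1 + k + 1) = q ^ 2 * q ^ M * q ^ k := by ring
    have g3 : q ^ (2 * (M + 1)) = q ^ 2 * (q ^ M) ^ 2 := by ring
    rw [g1] at f6 ⊢
    rw [g2] at e0 ⊢
    rw [g3, pow_succ' q M, pow_succ (-1 : K) M]
    generalize q ^ M = x at e0 f4 f6 ⊢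
    generalize q ^ k = y at e0 f5 f6 ⊢
    obtain ⟨w, hw⟩ : ∃ w, w = 1 - a * q ^ 3 * x ^ 2 * y := ⟨_, rfl⟩
    obtain ⟨v, hv⟩ : ∃ v, v = 1 - q ^ 2 * x * y := ⟨_, rfl⟩
    obtain ⟨s, hs⟩ : ∃ s, s = 1 - q * x := ⟨_, rfl⟩
    obtain ⟨t, ht⟩ : ∃ t, t = 1 - q * y := ⟨_, rfl⟩
    rw [← hw] at f6 ⊢
    rw [← hv] at e0 ⊢
    rw [← hs] at f4 ⊢
    rw [← ht] at f5 ⊢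
    field_simp
    rw [hw, hv, hs, ht]
    ring

theorem baileyBeta_unitAlpha (a q : K) (n : ℕ) (hq : qPoch q q n ≠ 0)
    (ha : qPoch (a * q) q (2 * n) ≠ 0) :
    baileyBeta a q (unitAlpha a q) n = if n = 0 then 1 else 0 := by
  cases n with
  | zero => simp [baileyBeta, unitAlpha_zero]
  | succ n =>
    rw [baileyBeta, sum_range_succ, unitAlpha_partial_sum a q n hq ha n le_rfl,
      unitAlpha_succ a q n (qPoch_ne_zero_of_le ha (by omega)) hq, if_neg n.succ_ne_zero,
      Nat.sub_self, Nat.sub_self, qPoch_zero, qPoch_succ q q n,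
      show n + 1 + (n + 1) = n + 1 + n + 1 by ring, qPoch_succ (a * q) q (n + 1 + n)]
    have f1 : qPoch q q n ≠ 0 := qPoch_ne_zero_of_le hq (by omega)
    have f3 : qPoch (a * q) q (n + 1 + n) ≠ 0 := qPoch_ne_zero_of_le ha (by omega)
    have f4 : 1 - q * q ^ n ≠ 0 := qPoch_ne_zero_iff.1 hq n (by omega)
    have f6 : 1 - a * q * q ^ (n + 1 + n) ≠ 0 := qPoch_ne_zero_iff.1 ha _ (by omega)
    rw [pow_succ' q n]
    generalize qPoch (a * q) q (n + 1 + n) = A at f3 ⊢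
    generalize qPoch (a * q) q n = B
    have g1 : a * q * q ^ (n + 1 + n) = a * q ^ 2 * (q ^ n) ^ 2 := by ring
    have g3 : q ^ (2 * (n + 1)) = q ^ 2 * (q ^ n) ^ 2 := by ring
    rw [g1] at f6 ⊢
    rw [g3, ← mul_assoc a, pow_succ (-1 : K) n]
    generalize q ^ n = x at f4 f6 ⊢
    generalize 1 - a * q ^ 2 * x ^ 2 = w at f6 ⊢
    generalize 1 - q * x = v at f4 ⊢
    field_simp
    ring

/-- The homogeneous terminating very-well-poised `₆φ₅` sum. -/
theorem sixPhiFive (a q X Y Z : K) (n : ℕ) (hq : qPoch q q n ≠ 0)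
    (ha : qPoch (a * q) q (2 * n) ≠ 0) :
    ∑ s ∈ range (n + 1), q ^ s * quadProd Y Z (a * X) q s *
        quadProd X (Z * q ^ (s + 1)) (a * Y * q ^ (2 * s + 2)) q (n - s) /
          (qPoch q q (n - s) * qPoch (a * q) q (n + s)) * unitAlpha a q s =
      quadProd X (Y * q) 0 q n / qPoch q q n := by
  -- For the unit pair only the term m = 0 survives on the β side of the Bailey lemma.
  rw [← bailey_lemma a q X Y Z _ n hq ha, sum_eq_single 0]
  · simp [baileyBeta_unitAlpha]
  · intro m hm hm0
    rw [baileyBeta_unitAlpha, if_neg hm0, mul_zero]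
    · exact qPoch_ne_zero_of_le hq (Nat.lt_succ_iff.1 (mem_range.1 hm))
    · exact qPoch_ne_zero_of_le ha (by have := mem_range.1 hm; omega)
  · simp

end Basic

/-! ### Specialisations of the Bailey lemma: changes of base and chain steps. -/

section Change

variable {K : Type*} [Field K]

theorem choose_two_add (m k : ℕ) : (m + k).choose 2 = m.choose 2 + k.choose 2 + m * k := by
  induction k with
  | zero => simp
  | succ k ih =>
    rw [← add_assoc, Nat.choose_succ_succ' _ 1, Nat.choose_succ_succ' k 1, ih,
      Nat.choose_one_right, Nat.choose_one_right]
    ring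

theorem two_mul_choose_two (k : ℕ) : 2 * k.choose 2 + k = k ^ 2 := by
  induction k with
  | zero => simp
  | succ k ih =>
    rw [Nat.choose_succ_succ' k 1, Nat.choose_one_right]
    linarith

theorem quadProd_eq_qPoch (y q : K) (n : ℕ) : quadProd 1 y 0 q n = qPoch y q n := by
  simp [quadProd, qPoch]

@[simp] theorem qPoch_zero_left (q : K) (n : ℕ) : qPoch 0 q n = 1 := by simp [qPoch]

theorem quadProd_ne_zero_of_le {x y z q : K} {m n : ℕ} (h : quadProd x y z q n ≠ 0) (hmn : m ≤ n) :
    quadProd x y z q m ≠ 0 := by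
  obtain ⟨k, rfl⟩ := Nat.exists_eq_add_of_le hmn
  rw [quadProd_add] at h
  exact left_ne_zero_of_mul h

theorem quadProd_smul (c x y z q : K) (n : ℕ) :
    quadProd (c * x) (c * y) (c * z) q n = c ^ n * quadProd x y z q n := by
  induction n with
  | zero => simp
  | succ n ih => rw [quadProd_succ, quadProd_succ, ih]; ring

/-- Since zq^{2n} - yq^n t + t² at t = q^j is q^{2j}(1 - yq^{n-j} + zq^{2(n-j)}), the first product
consists of the top r factors of the right side. The stray powers add up to r(r-1), and q^r
completes this to r². -/
theorem quadProd_reverse (y z q : K) {r n : ℕ} (h : r ≤ n) :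
    q ^ r * quadProd (z * q ^ (2 * n)) (y * q ^ n) 1 q r * quadProd 1 (y * q) (z * q ^ 2) q (n - r) =
      q ^ (r ^ 2) * quadProd 1 (y * q) (z * q ^ 2) q n := by
  induction r with
  | zero => simp
  | succ r ih =>
    have ih' := ih (by omega)
    obtain ⟨k, rfl⟩ := Nat.exists_eq_add_of_le h
    rw [show r + 1 + k - r = k + 1 by omega, quadProd_succ _ _ _ _ k] at ih'
    rw [Nat.add_sub_cancel_left, quadProd_succ _ _ _ _ r,
      show q ^ ((r + 1) ^ 2) = q ^ (r ^ 2) * q ^ (2 * r + 1) by ring, mul_right_comm _ (q ^ (2 * r + 1)),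
      ← ih']
    ring

theorem quadProd_reverse_linear (y q : K) {r n : ℕ} (h : r ≤ n) :
    quadProd (-(y * q ^ n)) (-1) 0 q r * qPoch (y * q) q (n - r) =
      q ^ r.choose 2 * qPoch (y * q) q n := by
  induction r with
  | zero => simp
  | succ r ih =>
    have ih' := ih (by omega)
    obtain ⟨k, rfl⟩ := Nat.exists_eq_add_of_le h
    rw [show r + 1 + k - r = k + 1 by omega, qPoch_succ] at ih'
    rw [Nat.add_sub_cancel_left, quadProd_succ, Nat.choose_succ_succ' r 1, Nat.choose_one_right,
      pow_add q r (r.choose 2), mul_assoc (q ^ r), ← ih']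
    ring

theorem quadProd_linear (x q : K) (n : ℕ) :
    quadProd 0 (x * q) 0 q n = (-x) ^ n * q ^ (n + 1).choose 2 := by
  induction n with
  | zero => simp
  | succ n ih =>
    rw [quadProd_succ, ih, Nat.choose_succ_succ' (n + 1) 1, Nat.choose_one_right]
    ring

theorem quadProd_quadratic (x q : K) (n : ℕ) :
    quadProd 0 0 x q n * q ^ n = x ^ n * q ^ (n ^ 2) := by
  induction n with
  | zero => simp
  | succ n ih =>
    rw [quadProd_succ, show q ^ ((n + 1) ^ 2) = q ^ (n ^ 2) * q ^ (2 * n + 1) by ring,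
      pow_succ x, mul_mul_mul_comm, ← ih]
    ring

/-- With Y = azq^{2n} and Z = ayq^n the numerator of the Bailey lemma is read backwards: it becomes
a quotient of products ending at n and at n-s. This is where the weight a^s q^{s²} arises. -/
theorem poised_numerator (a q y z : K) {s n : ℕ} (hs : s ≤ n)
    (h : quadProd 1 (y * q) (z * q ^ 2) q n ≠ 0) :
    q ^ s * quadProd (a * z * q ^ (2 * n)) (a * y * q ^ n) (a * 1) q s =
      quadProd 1 (y * q) (z * q ^ 2) q n * (a ^ s * q ^ (s ^ 2)) /
        quadProd 1 (y * q) (z * q ^ 2) q (n - s) := by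
  rw [eq_div_iff (quadProd_ne_zero_of_le h (Nat.sub_le n s)), mul_assoc a, mul_assoc a,
    quadProd_smul]
  linear_combination a ^ s * quadProd_reverse y z q hs

/-- Under the same specialisation the other quadratic product is a block of consecutive factors,
from n+s+1 to n+m. -/
theorem poised_denominator (a q y z : K) {s m n : ℕ} (hs : s ≤ m)
    (h : quadProd 1 (a * y * q) (a ^ 2 * z * q ^ 2) q (n + m) ≠ 0) :
    quadProd 1 (a * y * q ^ n * q ^ (s + 1)) (a * (a * z * q ^ (2 * n)) * q ^ (2 * s + 2)) q (m - s) =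
      quadProd 1 (a * y * q) (a ^ 2 * z * q ^ 2) q (n + m) /
        quadProd 1 (a * y * q) (a ^ 2 * z * q ^ 2) q (n + s) := by
  obtain ⟨k, rfl⟩ := Nat.exists_eq_add_of_le hs
  rw [eq_div_iff (quadProd_ne_zero_of_le h (by omega)), mul_comm, ← add_assoc,
    quadProd_add _ _ _ _ (n + s), Nat.add_sub_cancel_left]
  congr 2 <;> ring

/-- Sums `∑ α_s / (…)` in which both denominators are enlarged by a product of quadratic factors. -/
theorem sum_change_of_base (a q y z : K) (α : ℕ → K) (n : ℕ) (hq : qPoch q q n ≠ 0)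
    (ha : qPoch (a * q) q (2 * n) ≠ 0) (h1 : quadProd 1 (y * q) (z * q ^ 2) q n ≠ 0)
    (h2 : quadProd 1 (a * y * q) (a ^ 2 * z * q ^ 2) q (2 * n) ≠ 0) :
    ∑ s ∈ range (n + 1), a ^ s * q ^ (s ^ 2) * α s /
      ((qPoch q q (n - s) * quadProd 1 (y * q) (z * q ^ 2) q (n - s)) *
        (qPoch (a * q) q (n + s) * quadProd 1 (a * y * q) (a ^ 2 * z * q ^ 2) q (n + s))) =
    1 / quadProd 1 (a * y * q) (a ^ 2 * z * q ^ 2) q (2 * n) *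
      ∑ m ∈ range (n + 1), a ^ m * q ^ (m ^ 2) * qPoch (a * z * q ^ (2 * n + 1)) q (n - m) /
        (qPoch q q (n - m) * quadProd 1 (y * q) (z * q ^ 2) q (n - m)) * baileyBeta a q α m := by
  have key := bailey_lemma a q 1 (a * z * q ^ (2 * n)) (a * y * q ^ n) α n hq ha
  have hP := fun m (hm : m ≤ n) => poised_numerator a q y z hm h1
  have hT := fun s (hs : s ≤ n) => poised_denominator a q y z hs (by rwa [← two_mul])
  simp only [← two_mul n] at hT
  have hL : ∑ m ∈ range (n + 1), q ^ m * quadProd (a * z * q ^ (2 * n)) (a * y * q ^ n) (a * 1) q m *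
        quadProd 1 (a * z * q ^ (2 * n) * q) 0 q (n - m) / qPoch q q (n - m) * baileyBeta a q α m =
      quadProd 1 (y * q) (z * q ^ 2) q n *
      ∑ m ∈ range (n + 1), a ^ m * q ^ (m ^ 2) * qPoch (a * z * q ^ (2 * n + 1)) q (n - m) /
        (qPoch q q (n - m) * quadProd 1 (y * q) (z * q ^ 2) q (n - m)) * baileyBeta a q α m := by
    rw [mul_sum]
    refine sum_congr rfl fun m hm => ?_
    rw [hP m (Nat.lt_succ_iff.1 (mem_range.1 hm)), quadProd_eq_qPoch,
      show a * z * q ^ (2 * n) * q = a * z * q ^ (2 * n + 1) by ring]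
    simp only [div_eq_mul_inv, mul_inv]
    ring
  have hR : ∑ s ∈ range (n + 1), q ^ s * quadProd (a * z * q ^ (2 * n)) (a * y * q ^ n) (a * 1) q s *
        quadProd 1 (a * y * q ^ n * q ^ (s + 1)) (a * (a * z * q ^ (2 * n)) * q ^ (2 * s + 2)) q
          (n - s) / (qPoch q q (n - s) * qPoch (a * q) q (n + s)) * α s =
      quadProd 1 (y * q) (z * q ^ 2) q n * quadProd 1 (a * y * q) (a ^ 2 * z * q ^ 2) q (2 * n) *
      ∑ s ∈ range (n + 1), a ^ s * q ^ (s ^ 2) * α s /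
      ((qPoch q q (n - s) * quadProd 1 (y * q) (z * q ^ 2) q (n - s)) *
        (qPoch (a * q) q (n + s) * quadProd 1 (a * y * q) (a ^ 2 * z * q ^ 2) q (n + s))) := by
    rw [mul_sum]
    refine sum_congr rfl fun s hs => ?_
    have hs' := Nat.lt_succ_iff.1 (mem_range.1 hs)
    rw [hP s hs', hT s hs']
    simp only [div_eq_mul_inv, mul_inv]
    ring
  rw [hL, hR, mul_assoc (quadProd 1 (y * q) (z * q ^ 2) q n)] at key
  rw [mul_left_cancel₀ h1 key]
  rw [one_div, inv_mul_cancel_left₀ h2]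

/-- The companion of `sum_change_of_base` under `q ↦ 1/q`, for linear factors. -/
theorem sum_change_of_base_dual (a q y : K) (hq0 : q ≠ 0) (α : ℕ → K) (n : ℕ)
    (hq : qPoch q q n ≠ 0) (ha : qPoch (a * q) q (2 * n) ≠ 0) (h1 : qPoch (y * q) q n ≠ 0)
    (h2 : qPoch (a * y * q) q (2 * n) ≠ 0) :
    ∑ s ∈ range (n + 1), α s /
      ((qPoch q q (n - s) * qPoch (y * q) q (n - s)) *
        (qPoch (a * q) q (n + s) * qPoch (a * y * q) q (n + s))) =
    1 / qPoch (a * y * q) q (2 * n) *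
      ∑ m ∈ range (n + 1), y ^ (n - m) * q ^ ((n - m) ^ 2) /
        (qPoch q q (n - m) * qPoch (y * q) q (n - m)) * baileyBeta a q α m := by
  -- With X = 0 the quadratics degenerate: -yq^n + t is t(1 - yq^n/t), and the product on the α side
  -- is a power of q times linear factors 1 - ayq^{n+s+1}t. The powers of q combine to one
  -- independent of s, so α keeps no weight.
  have key := bailey_lemma a q 0 (-(y * q ^ n)) (-1) α n hq ha
  have hP : ∀ m ≤ n, quadProd (-(y * q ^ n)) (-1) (a * 0) q m =
      qPoch (y * q) q n * q ^ m.choose 2 / qPoch (y * q) q (n - m) := by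
    intro m hm
    rw [eq_div_iff (qPoch_ne_zero_of_le h1 (Nat.sub_le n m)), mul_zero,
      quadProd_reverse_linear y q hm, mul_comm]
  have hT : ∀ s ≤ n, q ^ (s + 1).choose 2 * quadProd 0 (-1 * q ^ (s + 1))
      (a * (-(y * q ^ n)) * q ^ (2 * s + 2)) q (n - s) =
      q ^ (n + 1).choose 2 * qPoch (a * y * q) q (2 * n) / qPoch (a * y * q) q (n + s) := by
    intro s hs
    rw [eq_div_iff (qPoch_ne_zero_of_le h2 (by omega))]
    obtain ⟨k, hk⟩ := Nat.exists_eq_add_of_le hs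
    have : ∀ k, q ^ (s + 1).choose 2 * quadProd 0 (-1 * q ^ (s + 1))
        (a * (-(y * q ^ n)) * q ^ (2 * s + 2)) q k * qPoch (a * y * q) q (n + s) =
        q ^ (s + k + 1).choose 2 * qPoch (a * y * q) q (n + s + k) := by
      intro k
      induction k with
      | zero => simp
      | succ k ih =>
        rw [quadProd_succ, ← mul_assoc, mul_right_comm, ih, ← add_assoc (n + s), qPoch_succ,
          ← add_assoc s, Nat.choose_succ_succ' (s + k + 1) 1, Nat.choose_one_right]
        ring
    rw [show n - s = k by omega, this k, show n + s + k = 2 * n by omega, ← hk]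
  have hL : ∑ m ∈ range (n + 1), q ^ m * quadProd (-(y * q ^ n)) (-1) (a * 0) q m *
        quadProd 0 (-(y * q ^ n) * q) 0 q (n - m) / qPoch q q (n - m) * baileyBeta a q α m =
      (qPoch (y * q) q n * q ^ (n + 1).choose 2) *
      ∑ m ∈ range (n + 1), y ^ (n - m) * q ^ ((n - m) ^ 2) /
        (qPoch q q (n - m) * qPoch (y * q) q (n - m)) * baileyBeta a q α m := by
    rw [mul_sum]
    refine sum_congr rfl fun m hm => ?_
    have hm' := Nat.lt_succ_iff.1 (mem_range.1 hm)
    rw [hP m hm', quadProd_linear, neg_neg]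
    obtain ⟨k, rfl⟩ := Nat.exists_eq_add_of_le hm'
    rw [Nat.add_sub_cancel_left]
    have e : q ^ m * q ^ m.choose 2 * (q ^ (m + k)) ^ k * q ^ (k + 1).choose 2 =
        q ^ (m + k + 1).choose 2 * q ^ (k ^ 2) := by
      rw [← pow_mul, ← pow_add, ← pow_add, ← pow_add, ← pow_add]
      congr 1
      rw [Nat.choose_succ_succ' (m + k) 1, Nat.choose_succ_succ' k 1, choose_two_add]
      simp only [Nat.choose_one_right]
      ring
    rw [mul_pow]
    simp only [div_eq_mul_inv, mul_inv]
    linear_combination (qPoch (y * q) q (m + k) * (qPoch (y * q) q k)⁻¹ * y ^ k *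
      (qPoch q q k)⁻¹ * baileyBeta a q α m) * e
  have hR : ∑ s ∈ range (n + 1), q ^ s * quadProd (-(y * q ^ n)) (-1) (a * 0) q s *
        quadProd 0 (-1 * q ^ (s + 1)) (a * (-(y * q ^ n)) * q ^ (2 * s + 2)) q
          (n - s) / (qPoch q q (n - s) * qPoch (a * q) q (n + s)) * α s =
      (qPoch (y * q) q n * q ^ (n + 1).choose 2) * (qPoch (a * y * q) q (2 * n) *
      ∑ s ∈ range (n + 1), α s /
      ((qPoch q q (n - s) * qPoch (y * q) q (n - s)) *
        (qPoch (a * q) q (n + s) * qPoch (a * y * q) q (n + s)))) := by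
    rw [mul_sum, mul_sum]
    refine sum_congr rfl fun s hs => ?_
    have hs' := Nat.lt_succ_iff.1 (mem_range.1 hs)
    have hT' := hT s hs'
    rw [Nat.choose_succ_succ' s 1, Nat.choose_one_right, pow_add] at hT'
    rw [hP s hs']
    simp only [div_eq_mul_inv, mul_inv] at hT' ⊢
    linear_combination (qPoch (y * q) q n * (qPoch (y * q) q (n - s))⁻¹ * α s *
      (qPoch q q (n - s))⁻¹ * (qPoch (a * q) q (n + s))⁻¹) * hT'
  rw [hL, hR] at key
  rw [mul_left_cancel₀ (mul_ne_zero h1 (pow_ne_zero _ hq0)) key]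
  rw [one_div, inv_mul_cancel_left₀ h2]

/-- This is the case y = z = 0, where the base stays the same. -/
theorem baileyBeta_chain (a q : K) (α : ℕ → K) (n : ℕ) (hq : qPoch q q n ≠ 0)
    (ha : qPoch (a * q) q (2 * n) ≠ 0) :
    baileyBeta a q (fun s => a ^ s * q ^ (s ^ 2) * α s) n =
      ∑ m ∈ range (n + 1), a ^ m * q ^ (m ^ 2) / qPoch q q (n - m) * baileyBeta a q α m := by
  have := sum_change_of_base a q 0 0 α n hq ha (by simp [quadProd]) (by simp [quadProd])
  simpa [quadProd_eq_qPoch, baileyBeta] using this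

/-- The chain step inverse to `baileyBeta_chain`. -/
theorem baileyBeta_chain_dual (a q : K) (ha0 : a ≠ 0) (hq0 : q ≠ 0) (α : ℕ → K) (n : ℕ)
    (hq : qPoch q q n ≠ 0) (ha : qPoch (a * q) q (2 * n) ≠ 0) :
    a ^ n * q ^ (n ^ 2 + n) * baileyBeta a q (fun s => α s / (a ^ s * q ^ (s ^ 2))) n =
      ∑ m ∈ range (n + 1), q ^ m * (-1) ^ (n - m) * q ^ (n - m + 1).choose 2 / qPoch q q (n - m) *
        baileyBeta a q α m := by
  -- Both roots are sent to 0. The numerator is then 1, and the remaining quadratic product is a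
  -- monomial which carries the inverse weight.
  have key := bailey_lemma a q 0 1 0 α n hq ha
  have hL : ∀ m, quadProd 1 0 (a * 0) q m = 1 := by simp [quadProd]
  have hR : ∀ m, quadProd 0 (1 * q) 0 q m = (-1) ^ m * q ^ (m + 1).choose 2 := quadProd_linear 1 q
  simp only [hL, hR, zero_mul, mul_one] at key
  simp only [mul_assoc] at key ⊢
  rw [key, baileyBeta, mul_sum, mul_sum]
  refine sum_congr rfl fun s hs => ?_
  obtain ⟨k, rfl⟩ := Nat.exists_eq_add_of_le (Nat.lt_succ_iff.1 (mem_range.1 hs))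
  rw [Nat.add_sub_cancel_left]
  have h := quadProd_quadratic (a * q ^ (2 * s + 2)) q k
  have h' : quadProd 0 0 (a * q ^ (2 * s + 2)) q k = a ^ k * q ^ (2 * s * k + k ^ 2 + k) := by
    apply mul_right_cancel₀ (pow_ne_zero k hq0)
    rw [h]; ring
  rw [h', show (s + k) ^ 2 + (s + k) = (2 * s * k + k ^ 2 + k) + s ^ 2 + s by ring, pow_add a,
    pow_add q _ s, pow_add q _ (s ^ 2)]
  field_simp

end Change

/-! ### Bases q² and q³, and the formulas with d = 1 obtained by composing steps. -/

section Transformations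

variable {K : Type*} [Field K]

theorem qPoch_sq (x q : K) (n : ℕ) : qPoch (x ^ 2) (q ^ 2) n = qPoch x q n * qPoch (-x) q n := by
  rw [qPoch, qPoch, qPoch, ← prod_mul_distrib]
  exact prod_congr rfl fun j _ => by ring

theorem qPoch_cube (x q : K) (n : ℕ) :
    qPoch (x ^ 3) (q ^ 3) n = qPoch x q n * quadProd 1 (-x) (x ^ 2) q n := by
  rw [qPoch, qPoch, quadProd, ← prod_mul_distrib]
  exact prod_congr rfl fun j _ => by ring

/-- Of the factors of 1-x⁴, the pair (1+x)(1+ix) is kept as one quadratic and 1-ix is left alone, so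
that base q⁴ can be reached by one quadratic and one linear extension. -/
theorem qPoch_fourth {i : K} (hi : i ^ 2 = -1) (x q : K) (n : ℕ) :
    qPoch (x ^ 4) (q ^ 4) n =
      qPoch x q n * quadProd 1 (-(1 + i) * x) (i * x ^ 2) q n * qPoch (i * x) q n := by
  rw [qPoch, qPoch, qPoch, quadProd, ← prod_mul_distrib, ← prod_mul_distrib]
  refine prod_congr rfl fun j _ => ?_
  linear_combination ((x * q ^ j) ^ 2 - (x * q ^ j) ^ 4) * hi

/-- Change of base `q → q²`. -/
theorem baileyBeta_sq (a q : K) (α : ℕ → K) (n : ℕ) (hq : qPoch (q ^ 2) (q ^ 2) n ≠ 0)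
    (ha : qPoch (a ^ 2 * q ^ 2) (q ^ 2) (2 * n) ≠ 0) :
    baileyBeta (a ^ 2) (q ^ 2) (fun s => a ^ s * q ^ (s ^ 2) * α s) n =
      1 / qPoch (-(a * q)) q (2 * n) * ∑ m ∈ range (n + 1),
        a ^ m * q ^ (m ^ 2) / qPoch (q ^ 2) (q ^ 2) (n - m) * baileyBeta a q α m := by
  rw [← mul_pow] at ha
  simp only [baileyBeta, ← mul_pow, qPoch_sq] at ha hq ⊢
  have := sum_change_of_base a q (-1) 0 α n (left_ne_zero_of_mul hq) (left_ne_zero_of_mul ha)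
    (by simpa [quadProd_eq_qPoch] using right_ne_zero_of_mul hq)
    (by simpa [quadProd_eq_qPoch] using right_ne_zero_of_mul ha)
  simpa [quadProd_eq_qPoch, qPoch_zero_left, baileyBeta] using this

/-- Change of base `q → q²`, dual form. -/
theorem baileyBeta_sq_dual (a q : K) (hq0 : q ≠ 0) (α : ℕ → K) (n : ℕ)
    (hq : qPoch (q ^ 2) (q ^ 2) n ≠ 0) (ha : qPoch (a ^ 2 * q ^ 2) (q ^ 2) (2 * n) ≠ 0) :
    baileyBeta (a ^ 2) (q ^ 2) α n =
      1 / qPoch (-(a * q)) q (2 * n) * ∑ m ∈ range (n + 1),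
        (-1) ^ (n - m) * q ^ ((n - m) ^ 2) / qPoch (q ^ 2) (q ^ 2) (n - m) *
          baileyBeta a q α m := by
  rw [← mul_pow] at ha
  simp only [baileyBeta, ← mul_pow, qPoch_sq] at ha hq ⊢
  have := sum_change_of_base_dual a q (-1) hq0 α n (left_ne_zero_of_mul hq)
    (left_ne_zero_of_mul ha) (by simpa using right_ne_zero_of_mul hq)
    (by simpa using right_ne_zero_of_mul ha)
  simpa [baileyBeta] using this

/-- Change of base `q → q³`. -/
theorem baileyBeta_cube (a q : K) (α : ℕ → K) (n : ℕ) (hq : qPoch (q ^ 3) (q ^ 3) n ≠ 0)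
    (ha : qPoch (a ^ 3 * q ^ 3) (q ^ 3) (2 * n) ≠ 0) :
    baileyBeta (a ^ 3) (q ^ 3) (fun s => a ^ s * q ^ (s ^ 2) * α s) n =
      1 / qPoch (a ^ 3 * q ^ 3) (q ^ 3) (2 * n) * ∑ m ∈ range (n + 1),
        a ^ m * q ^ (m ^ 2) * qPoch (a * q) q (3 * n - m) / qPoch (q ^ 3) (q ^ 3) (n - m) *
          baileyBeta a q α m := by
  rw [← mul_pow] at ha ⊢
  have ha' := ha
  have hq' := hq
  rw [qPoch_cube] at ha' hq'
  have e1 : ∀ m, quadProd 1 (-1 * q) (1 * q ^ 2) q m = quadProd 1 (-q) (q ^ 2) q m := by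
    intro m; congr 1 <;> ring
  have e2 : ∀ m, quadProd 1 (a * -1 * q) (a ^ 2 * 1 * q ^ 2) q m =
      quadProd 1 (-(a * q)) ((a * q) ^ 2) q m := by
    intro m; congr 1 <;> ring
  have := sum_change_of_base a q (-1) 1 α n (left_ne_zero_of_mul hq') (left_ne_zero_of_mul ha')
    (by rw [e1]; exact right_ne_zero_of_mul hq') (by rw [e2]; exact right_ne_zero_of_mul ha')
  simp only [e1, e2, ← qPoch_cube] at this
  rw [baileyBeta]
  simp only [← mul_pow]
  rw [this, qPoch_cube (a * q) q (2 * n), mul_sum, mul_sum]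
  refine sum_congr rfl fun m hm => ?_
  have hm' := mem_range.1 hm
  -- Because z = 1, the factor (aq^{2n+1};q)_{n-m} continues (aq;q)_{2n} to (aq;q)_{3n-m}.
  rw [show 3 * n - m = 2 * n + (n - m) by omega, qPoch_add (a * q),
    show a * 1 * q ^ (2 * n + 1) = a * q * q ^ (2 * n) by ring]
  have h1 := left_ne_zero_of_mul ha'
  simp only [div_eq_mul_inv, mul_inv]
  rw [mul_mul_mul_comm]
  field_simp

/-- For d = 1 every weight is a power of a^s q^{s²}. A weighted step in base q^e contributes e such
powers and a dual change of base none, so the target k prescribes which steps to compose. -/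
theorem smpAlpha_one (e k : ℕ) (a q : K) :
    smpAlpha 1 e (1 + k) a q = fun r => a ^ (k * r) * q ^ (k * r ^ 2) * unitAlpha a q r := by
  funext r
  simp only [smpAlpha, unitAlpha, one_dvd, if_true, Nat.div_one, pow_one]
  rw [show (((1 + k : ℕ) : ℤ) - (1 : ℕ)) * (r : ℤ) = ((k * r : ℕ) : ℤ) by push_cast; ring,
    show ((1 : ℕ) : ℤ) * (((1 + k : ℕ) : ℤ) - (1 : ℕ)) * (r : ℤ) ^ 2
      + ((1 : ℕ) : ℤ) * ((r.choose 2 : ℕ) : ℤ) = ((k * r ^ 2 + r.choose 2 : ℕ) : ℤ) by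
        push_cast; ring, zpow_natCast, zpow_natCast, pow_add]
  ring

theorem sum_mul_baileyBeta_unitAlpha (a q : K) (c : ℕ → K) (n : ℕ) (hq : qPoch q q n ≠ 0)
    (ha : qPoch (a * q) q (2 * n) ≠ 0) :
    ∑ m ∈ range (n + 1), c m * baileyBeta a q (unitAlpha a q) m = c 0 := by
  rw [sum_eq_single 0]
  · simp [baileyBeta_unitAlpha]
  · intro m hm hm0
    have := mem_range.1 hm
    rw [baileyBeta_unitAlpha, if_neg hm0, mul_zero]
    · exact qPoch_ne_zero_of_le hq (by omega)
    · exact qPoch_ne_zero_of_le ha (by omega)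
  · simp

/-- The pair with `(d,e,k) = (1,2,2)`. -/
theorem baileyBeta_one_two_two (a q : K) (n : ℕ) (hq : qPoch (q ^ 2) (q ^ 2) n ≠ 0)
    (ha : qPoch (a ^ 2 * q ^ 2) (q ^ 2) (2 * n) ≠ 0) :
    baileyBeta (a ^ 2) (q ^ 2) (fun s => a ^ s * q ^ (s ^ 2) * unitAlpha a q s) n =
      1 / (qPoch (-(a * q)) q (2 * n) * qPoch (q ^ 2) (q ^ 2) n) := by
  rw [baileyBeta_sq a q _ n hq ha, sum_mul_baileyBeta_unitAlpha]
  · simp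
    ring
  · exact qPoch_ne_zero_of_pow hq rfl
  · exact qPoch_ne_zero_of_pow ha (mul_pow a q 2)

/-- The pair with `(d,e,k) = (1,2,1)`. -/
theorem baileyBeta_one_two_one (a q : K) (hq0 : q ≠ 0) (n : ℕ) (hq : qPoch (q ^ 2) (q ^ 2) n ≠ 0)
    (ha : qPoch (a ^ 2 * q ^ 2) (q ^ 2) (2 * n) ≠ 0) :
    baileyBeta (a ^ 2) (q ^ 2) (unitAlpha a q) n =
      (-1) ^ n * q ^ (n ^ 2) / (qPoch (-(a * q)) q (2 * n) * qPoch (q ^ 2) (q ^ 2) n) := by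
  rw [baileyBeta_sq_dual a q hq0 _ n hq ha, sum_mul_baileyBeta_unitAlpha]
  · simp only [Nat.sub_zero, div_eq_mul_inv, mul_inv]
    ring
  · exact qPoch_ne_zero_of_pow hq rfl
  · exact qPoch_ne_zero_of_pow ha (mul_pow a q 2)

/-- The pair with `(d,e,k) = (1,3,2)`. -/
theorem baileyBeta_one_three_two (a q : K) (n : ℕ) (hq : qPoch (q ^ 3) (q ^ 3) n ≠ 0)
    (ha : qPoch (a ^ 3 * q ^ 3) (q ^ 3) (2 * n) ≠ 0) :
    baileyBeta (a ^ 3) (q ^ 3) (fun s => a ^ s * q ^ (s ^ 2) * unitAlpha a q s) n =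
      qPoch (a * q) q (3 * n) /
        (qPoch (a ^ 3 * q ^ 3) (q ^ 3) (2 * n) * qPoch (q ^ 3) (q ^ 3) n) := by
  rw [baileyBeta_cube a q _ n hq ha, sum_mul_baileyBeta_unitAlpha]
  · simp only [Nat.sub_zero, div_eq_mul_inv, mul_inv]
    ring
  · exact qPoch_ne_zero_of_pow hq rfl
  · exact qPoch_ne_zero_of_pow ha (mul_pow a q 3)

/-- The base is changed to q² (weight 1), then a chain step is taken in base q² (weight 2). -/
theorem smpBeta_one_two_four (a q : K) (n : ℕ) (h : BetaDefined 2 a q n) :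
    smpBeta 1 2 4 a q n = ∑ r ∈ range (n + 1), a ^ (2 * r) * q ^ (2 * r ^ 2) /
      (qPoch (-(a * q)) q (2 * r) * qPoch (q ^ 2) (q ^ 2) r * qPoch (q ^ 2) (q ^ 2) (n - r)) := by
  obtain ⟨hq, ha⟩ := h
  have := baileyBeta_chain (a ^ 2) (q ^ 2) (fun s => a ^ s * q ^ (s ^ 2) * unitAlpha a q s) n hq ha
  rw [smpBeta, smpAlpha_one 2 3 a q]
  convert this using 1
  · congr 1; funext r; ring
  · refine sum_congr rfl fun m hm => ?_
    have hm' := mem_range.1 hm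
    rw [baileyBeta_one_two_two a q m (qPoch_ne_zero_of_le hq (by omega))
      (qPoch_ne_zero_of_le ha (by omega))]
    simp only [div_eq_mul_inv, mul_inv]
    ring

theorem smpBeta_one_three_five (a q : K) (n : ℕ) (h : BetaDefined 3 a q n) :
    smpBeta 1 3 5 a q n = ∑ r ∈ range (n + 1),
      a ^ (3 * r) * q ^ (3 * r ^ 2) * qPoch (a * q) q (3 * r) /
        (qPoch (a ^ 3 * q ^ 3) (q ^ 3) (2 * r) * qPoch (q ^ 3) (q ^ 3) r *
          qPoch (q ^ 3) (q ^ 3) (n - r)) := by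
  obtain ⟨hq, ha⟩ := h
  have := baileyBeta_chain (a ^ 3) (q ^ 3) (fun s => a ^ s * q ^ (s ^ 2) * unitAlpha a q s) n hq ha
  rw [smpBeta, smpAlpha_one 3 4 a q]
  convert this using 1
  · congr 1; funext r; ring
  · refine sum_congr rfl fun m hm => ?_
    have hm' := mem_range.1 hm
    rw [baileyBeta_one_three_two a q m (qPoch_ne_zero_of_le hq (by omega))
      (qPoch_ne_zero_of_le ha (by omega))]
    simp only [div_eq_mul_inv, mul_inv]
    ring

theorem smpBeta_one_four_four (a q : K) (n : ℕ) (h : BetaDefined 4 a q n) :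
    smpBeta 1 4 4 a q n = 1 / qPoch (-(a ^ 2 * q ^ 2)) (q ^ 2) (2 * n) *
      ∑ r ∈ range (n + 1), a ^ (2 * r) * q ^ (2 * r ^ 2) /
        (qPoch (q ^ 2) (q ^ 2) r * qPoch (-(a * q)) q (2 * r) * qPoch (q ^ 4) (q ^ 4) (n - r)) := by
  obtain ⟨hq, ha⟩ := h
  have ea : a ^ 4 = (a ^ 2) ^ 2 := by ring
  have eq : q ^ 4 = (q ^ 2) ^ 2 := by ring
  rw [smpBeta, smpAlpha_one 4 3 a q]
  simp only [ea, eq] at hq ha ⊢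
  have hq2 := qPoch_ne_zero_of_pow hq rfl
  have ha2 := qPoch_ne_zero_of_pow ha (mul_pow (a ^ 2) (q ^ 2) 2)
  have := baileyBeta_sq (a ^ 2) (q ^ 2) (fun s => a ^ s * q ^ (s ^ 2) * unitAlpha a q s) n hq ha
  convert this using 1
  · congr 1; funext r; ring
  · congr 1
    refine sum_congr rfl fun m hm => ?_
    have hm' := mem_range.1 hm
    rw [baileyBeta_one_two_two a q m (qPoch_ne_zero_of_le hq2 (by omega))
      (qPoch_ne_zero_of_le ha2 (by omega))]
    simp only [div_eq_mul_inv, mul_inv]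
    ring

/-- Two dual changes of base, q to q² to q⁴, leave the unit α unweighted. -/
theorem smpBeta_one_four_one (a q : K) (hq0 : q ≠ 0) (n : ℕ) (h : BetaDefined 4 a q n) :
    smpBeta 1 4 1 a q n =
      (-1) ^ n * q ^ (2 * n ^ 2) / qPoch (-(a ^ 2 * q ^ 2)) (q ^ 2) (2 * n) *
        ∑ r ∈ range (n + 1), q ^ (3 * (r : ℤ) ^ 2 - 4 * n * r) /
          (qPoch (q ^ 2) (q ^ 2) r * qPoch (-(a * q)) q (2 * r) *
            qPoch (q ^ 4) (q ^ 4) (n - r)) := by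
  obtain ⟨hq, ha⟩ := h
  have ea : a ^ 4 = (a ^ 2) ^ 2 := by ring
  have eq : q ^ 4 = (q ^ 2) ^ 2 := by ring
  rw [smpBeta, smpAlpha_one 4 0 a q]
  simp only [ea, eq] at hq ha ⊢
  have hq2 := qPoch_ne_zero_of_pow hq rfl
  have ha2 := qPoch_ne_zero_of_pow ha (mul_pow (a ^ 2) (q ^ 2) 2)
  have := baileyBeta_sq_dual (a ^ 2) (q ^ 2) (pow_ne_zero 2 hq0) (unitAlpha a q) n hq ha
  convert this using 1
  · congr 1; funext r; ring
  · rw [mul_sum, mul_sum]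
    refine sum_congr rfl fun m hm => ?_
    have hm' := mem_range.1 hm
    rw [baileyBeta_one_two_one a q hq0 m (qPoch_ne_zero_of_le hq2 (by omega))
      (qPoch_ne_zero_of_le ha2 (by omega))]
    obtain ⟨k, rfl⟩ := Nat.exists_eq_add_of_le (Nat.lt_succ_iff.1 hm')
    rw [Nat.add_sub_cancel_left]
    have e : q ^ (2 * (m + k) ^ 2) * q ^ (3 * (m : ℤ) ^ 2 - 4 * (m + k : ℕ) * m) =
        (q ^ 2) ^ (k ^ 2) * q ^ (m ^ 2) := by
      rw [← zpow_natCast, ← zpow_add₀ hq0, ← pow_mul, ← pow_add, ← zpow_natCast]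
      congr 1
      push_cast
      ring
    have s : (-1 : K) ^ m * (-1) ^ m = 1 := by rw [← mul_pow]; simp
    rw [pow_add (-1 : K)]
    simp only [div_eq_mul_inv, mul_inv]
    linear_combination ((-1 : K) ^ m * (-1) ^ k * (qPoch (-(a ^ 2 * q ^ 2)) (q ^ 2) (2 * (m + k)))⁻¹
      * (qPoch (q ^ 2) (q ^ 2) m)⁻¹ * (qPoch (-(a * q)) q (2 * m))⁻¹ *
      (qPoch ((q ^ 2) ^ 2) ((q ^ 2) ^ 2) k)⁻¹) * e

theorem smpBeta_one_six_four (a q : K) (n : ℕ) (h : BetaDefined 6 a q n) :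
    smpBeta 1 6 4 a q n = 1 / qPoch (a ^ 6 * q ^ 6) (q ^ 6) (2 * n) *
      ∑ r ∈ range (n + 1), a ^ (2 * r) * q ^ (2 * r ^ 2) * qPoch (a ^ 2 * q ^ 2) (q ^ 2) (3 * n - r) /
        (qPoch (q ^ 2) (q ^ 2) r * qPoch (-(a * q)) q (2 * r) * qPoch (q ^ 6) (q ^ 6) (n - r)) := by
  obtain ⟨hq, ha⟩ := h
  have ea : a ^ 6 = (a ^ 2) ^ 3 := by ring
  have eq : q ^ 6 = (q ^ 2) ^ 3 := by ring
  rw [smpBeta, smpAlpha_one 6 3 a q]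
  simp only [ea, eq] at hq ha ⊢
  have hq2 := qPoch_ne_zero_of_pow hq rfl
  have ha2 := qPoch_ne_zero_of_pow ha (mul_pow (a ^ 2) (q ^ 2) 3)
  have := baileyBeta_cube (a ^ 2) (q ^ 2) (fun s => a ^ s * q ^ (s ^ 2) * unitAlpha a q s) n hq ha
  convert this using 1
  · congr 1; funext r; ring
  · congr 1
    refine sum_congr rfl fun m hm => ?_
    have hm' := mem_range.1 hm
    rw [baileyBeta_one_two_two a q m (qPoch_ne_zero_of_le hq2 (by omega))
      (qPoch_ne_zero_of_le ha2 (by omega))]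
    simp only [div_eq_mul_inv, mul_inv]
    ring

/-- The dual change to q² adds no weight, and the cubic change from q² to q⁶ adds 2. -/
theorem smpBeta_one_six_three (a q : K) (hq0 : q ≠ 0) (n : ℕ) (h : BetaDefined 6 a q n) :
    smpBeta 1 6 3 a q n = 1 / qPoch (a ^ 6 * q ^ 6) (q ^ 6) (2 * n) *
      ∑ r ∈ range (n + 1), (-1) ^ r * a ^ (2 * r) * q ^ (3 * r ^ 2) *
        qPoch (a ^ 2 * q ^ 2) (q ^ 2) (3 * n - r) /
        (qPoch (q ^ 2) (q ^ 2) r * qPoch (-(a * q)) q (2 * r) * qPoch (q ^ 6) (q ^ 6) (n - r)) := by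
  obtain ⟨hq, ha⟩ := h
  have ea : a ^ 6 = (a ^ 2) ^ 3 := by ring
  have eq : q ^ 6 = (q ^ 2) ^ 3 := by ring
  rw [smpBeta, smpAlpha_one 6 2 a q]
  simp only [ea, eq] at hq ha ⊢
  have hq2 := qPoch_ne_zero_of_pow hq rfl
  have ha2 := qPoch_ne_zero_of_pow ha (mul_pow (a ^ 2) (q ^ 2) 3)
  have := baileyBeta_cube (a ^ 2) (q ^ 2) (unitAlpha a q) n hq ha
  convert this using 1
  · congr 1; funext r; ring
  · congr 1
    refine sum_congr rfl fun m hm => ?_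
    have hm' := mem_range.1 hm
    rw [baileyBeta_one_two_one a q hq0 m (qPoch_ne_zero_of_le hq2 (by omega))
      (qPoch_ne_zero_of_le ha2 (by omega))]
    simp only [div_eq_mul_inv, mul_inv]
    ring

end Transformations

/-! ### Watson-type transformations through a pair depending on n. -/

section Watson

variable {K : Type*} [Field K]

/-- The unit pair weighted by a pair of numerator parameters depending on `n`. -/
def poisedAlpha (a q y z : K) (n s : ℕ) : K :=
  a ^ s * q ^ (s ^ 2) * unitAlpha a q s /
    (quadProd 1 (y * q) (z * q ^ 2) q (n - s) *
      quadProd 1 (a * y * q) (a ^ 2 * z * q ^ 2) q (n + s))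

theorem baileyBeta_poisedAlpha (a q y z : K) {m n : ℕ} (hm : m ≤ n) (hq : qPoch q q m ≠ 0)
    (ha : qPoch (a * q) q (2 * m) ≠ 0) (h1 : quadProd 1 (y * q) (z * q ^ 2) q n ≠ 0)
    (h2 : quadProd 1 (a * y * q) (a ^ 2 * z * q ^ 2) q (n + m) ≠ 0) :
    baileyBeta a q (poisedAlpha a q y z n) m = qPoch (a * z * q ^ (2 * n + 1)) q m /
      (qPoch q q m * quadProd 1 (y * q) (z * q ^ 2) q n *
        quadProd 1 (a * y * q) (a ^ 2 * z * q ^ 2) q (n + m)) := by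
  have key := sixPhiFive a q 1 (a * z * q ^ (2 * n)) (a * y * q ^ n) m hq ha
  have hL : ∑ s ∈ range (m + 1), q ^ s * quadProd (a * z * q ^ (2 * n)) (a * y * q ^ n) (a * 1) q s *
        quadProd 1 (a * y * q ^ n * q ^ (s + 1)) (a * (a * z * q ^ (2 * n)) * q ^ (2 * s + 2)) q
          (m - s) / (qPoch q q (m - s) * qPoch (a * q) q (m + s)) * unitAlpha a q s =
      quadProd 1 (y * q) (z * q ^ 2) q n * quadProd 1 (a * y * q) (a ^ 2 * z * q ^ 2) q (n + m) *
        baileyBeta a q (poisedAlpha a q y z n) m := by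
    rw [baileyBeta, mul_sum]
    refine sum_congr rfl fun s hs => ?_
    have hs' := Nat.lt_succ_iff.1 (mem_range.1 hs)
    rw [poised_numerator a q y z (hs'.trans hm) h1, poised_denominator a q y z hs' h2, poisedAlpha]
    simp only [div_eq_mul_inv, mul_inv]
    ring
  rw [hL, quadProd_eq_qPoch] at key
  rw [show a * z * q ^ (2 * n + 1) = a * z * q ^ (2 * n) * q by ring, mul_assoc (qPoch q q m),
    ← div_div, ← key, mul_div_cancel_left₀ _ (mul_ne_zero h1 h2)]

theorem smpBeta_one_two_three (a q : K) (n : ℕ) (h : BetaDefined 2 a q n) :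
    smpBeta 1 2 3 a q n = 1 / qPoch (-q) q n * ∑ r ∈ range (n + 1),
      a ^ r * q ^ (r ^ 2) / (qPoch q q r * qPoch q q (n - r) * qPoch (-(a * q)) q (n + r)) := by
  obtain ⟨hq, ha⟩ := h
  rw [← mul_pow] at ha
  rw [qPoch_sq] at hq ha
  have hq1 := left_ne_zero_of_mul hq
  have ha1 := left_ne_zero_of_mul ha
  -- The pair depends on n, which is harmless: the chain step is used only at index n, where the
  -- factors stored in α complete the denominators to base q².
  have key := baileyBeta_chain a q (poisedAlpha a q (-1) 0 n) n hq1 ha1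
  rw [smpBeta, smpAlpha_one 2 2 a q, baileyBeta, mul_sum]
  rw [baileyBeta] at key
  convert key using 1
  · refine sum_congr rfl fun s _ => ?_
    rw [← mul_pow, qPoch_sq, qPoch_sq, poisedAlpha, mul_zero, zero_mul,
      quadProd_eq_qPoch, quadProd_eq_qPoch, neg_one_mul, mul_neg_one, neg_mul]
    simp only [div_eq_mul_inv, mul_inv]
    ring
  · refine sum_congr rfl fun m hm => ?_
    have hm' := Nat.lt_succ_iff.1 (mem_range.1 hm)
    rw [baileyBeta_poisedAlpha a q (-1) 0 hm' (qPoch_ne_zero_of_le hq1 hm')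
      (qPoch_ne_zero_of_le ha1 (by omega)), mul_zero, mul_zero, zero_mul, zero_mul,
      quadProd_eq_qPoch, quadProd_eq_qPoch, neg_one_mul, mul_neg_one, neg_mul, qPoch_zero_left]
    · simp only [div_eq_mul_inv, mul_inv]
      ring
    · simpa [quadProd_eq_qPoch] using right_ne_zero_of_mul hq
    · simpa [quadProd_eq_qPoch] using
        qPoch_ne_zero_of_le (right_ne_zero_of_mul ha) (show n + m ≤ 2 * n by omega)

/-- The inner Bailey pair used for `e = 3`. -/
theorem baileyBeta_poisedAlpha_cube (a q : K) {m n : ℕ} (hm : m ≤ n)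
    (hq : qPoch (q ^ 3) (q ^ 3) n ≠ 0) (ha : qPoch (a ^ 3 * q ^ 3) (q ^ 3) (2 * n) ≠ 0) :
    baileyBeta a q (poisedAlpha a q (-1) 1 n) m =
      qPoch q q n / (qPoch (a * q) q (2 * n) * qPoch (q ^ 3) (q ^ 3) n) *
        (qPoch (a * q) q (2 * n + m) * qPoch (a * q) q (n + m) /
          (qPoch (a ^ 3 * q ^ 3) (q ^ 3) (n + m) * qPoch q q m)) := by
  have ham := qPoch_ne_zero_of_le ha (show n + m ≤ 2 * n by omega)
  rw [← mul_pow, qPoch_cube] at ha ham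
  rw [qPoch_cube] at hq
  have e1 : ∀ m, quadProd 1 (-1 * q) (1 * q ^ 2) q m = quadProd 1 (-q) (q ^ 2) q m := by
    intro m; congr 1 <;> ring
  have e2 : ∀ m, quadProd 1 (a * -1 * q) (a ^ 2 * 1 * q ^ 2) q m =
      quadProd 1 (-(a * q)) ((a * q) ^ 2) q m := by
    intro m; congr 1 <;> ring
  have h1 := left_ne_zero_of_mul hq
  have h2 := left_ne_zero_of_mul ha
  have h3 := left_ne_zero_of_mul ham
  rw [baileyBeta_poisedAlpha a q (-1) 1 hm (qPoch_ne_zero_of_le h1 hm)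
    (qPoch_ne_zero_of_le h2 (by omega)) (by rw [e1]; exact right_ne_zero_of_mul hq)
    (by rw [e2]; exact right_ne_zero_of_mul ham), e1, e2, ← mul_pow, qPoch_cube, qPoch_cube,
    qPoch_add (a * q) q (2 * n) m, show a * 1 * q ^ (2 * n + 1) = a * q * q ^ (2 * n) by ring]
  field_simp

theorem cube_denominator (a q : K) (n s : ℕ) :
    qPoch (q ^ 3) (q ^ 3) (n - s) * qPoch (a ^ 3 * q ^ 3) (q ^ 3) (n + s) =
      (qPoch q q (n - s) * qPoch (a * q) q (n + s)) *
      (quadProd 1 (-1 * q) (1 * q ^ 2) q (n - s) *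
        quadProd 1 (a * -1 * q) (a ^ 2 * 1 * q ^ 2) q (n + s)) := by
  rw [← mul_pow, qPoch_cube, qPoch_cube, mul_mul_mul_comm]
  congr 3 <;> ring

theorem smpBeta_one_three_three (a q : K) (n : ℕ) (h : BetaDefined 3 a q n) :
    smpBeta 1 3 3 a q n =
      qPoch q q n / (qPoch (a * q) q (2 * n) * qPoch (q ^ 3) (q ^ 3) n) *
        ∑ r ∈ range (n + 1),
          a ^ r * q ^ (r ^ 2) * qPoch (a * q) q (2 * n + r) * qPoch (a * q) q (n + r) /
            (qPoch (a ^ 3 * q ^ 3) (q ^ 3) (n + r) * qPoch q q r * qPoch q q (n - r)) := by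
  obtain ⟨hq, ha⟩ := h
  have key := baileyBeta_chain a q (poisedAlpha a q (-1) 1 n) n (qPoch_ne_zero_of_pow hq rfl)
    (qPoch_ne_zero_of_pow ha (mul_pow a q 3))
  rw [smpBeta, smpAlpha_one 3 2 a q, baileyBeta, mul_sum]
  rw [baileyBeta] at key
  convert key using 1
  · refine sum_congr rfl fun s _ => ?_
    rw [cube_denominator, poisedAlpha]
    simp only [div_eq_mul_inv, mul_inv]
    ring
  · refine sum_congr rfl fun m hm => ?_
    rw [baileyBeta_poisedAlpha_cube a q (Nat.lt_succ_iff.1 (mem_range.1 hm)) hq ha]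
    simp only [div_eq_mul_inv, mul_inv]
    ring

/-- The inverse chain step removes the weight a^s q^{s²} carried by `poisedAlpha`, leaving the bare
unit α. -/
theorem smpBeta_one_three_one (a q : K) (hq0 : q ≠ 0) (n : ℕ) (h : BetaDefined 3 a q n)
    (ha0 : a ≠ 0) :
    smpBeta 1 3 1 a q n =
      (-1) ^ n * a ^ (-(n : ℤ)) * q ^ (-((n + 1).choose 2 : ℤ)) * qPoch q q n /
          (qPoch (q ^ 3) (q ^ 3) n * qPoch (a * q) q (2 * n)) *
        ∑ r ∈ range (n + 1),
          (-1) ^ r * q ^ (((r + 1).choose 2 : ℤ) - n * r) *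
              qPoch (a * q) q (n + r) * qPoch (a * q) q (2 * n + r) /
            (qPoch (a ^ 3 * q ^ 3) (q ^ 3) (n + r) * qPoch q q r * qPoch q q (n - r)) := by
  obtain ⟨hq, ha⟩ := h
  have key := baileyBeta_chain_dual a q ha0 hq0 (poisedAlpha a q (-1) 1 n) n
    (qPoch_ne_zero_of_pow hq rfl) (qPoch_ne_zero_of_pow ha (mul_pow a q 3))
  have hc : a ^ n * q ^ (n ^ 2 + n) ≠ 0 := mul_ne_zero (pow_ne_zero _ ha0) (pow_ne_zero _ hq0)
  apply mul_left_cancel₀ hc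
  rw [smpBeta, smpAlpha_one 3 0 a q, baileyBeta]
  rw [baileyBeta] at key
  convert key using 1
  · congr 1
    refine sum_congr rfl fun s _ => ?_
    rw [cube_denominator, poisedAlpha]
    have := pow_ne_zero s ha0
    have := pow_ne_zero (s ^ 2) hq0
    simp only [div_eq_mul_inv, mul_inv]
    field_simp
    simp
  · rw [mul_sum, mul_sum]
    refine sum_congr rfl fun m hm => ?_
    rw [baileyBeta_poisedAlpha_cube a q (Nat.lt_succ_iff.1 (mem_range.1 hm)) hq ha]
    obtain ⟨k, rfl⟩ := Nat.exists_eq_add_of_le (Nat.lt_succ_iff.1 (mem_range.1 hm))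
    rw [Nat.add_sub_cancel_left]
    have e1 : a ^ (m + k) * a ^ (-((m + k : ℕ) : ℤ)) = 1 := by
      rw [← zpow_natCast, ← zpow_add₀ ha0, add_neg_cancel, zpow_zero]
    have e2 : q ^ ((m + k) ^ 2 + (m + k)) * q ^ (-((m + k + 1).choose 2 : ℤ)) *
        q ^ (((m + 1).choose 2 : ℤ) - (m + k : ℕ) * m) = q ^ m * q ^ (k + 1).choose 2 := by
      rw [← zpow_natCast, ← zpow_add₀ hq0, ← zpow_add₀ hq0, ← pow_add, ← zpow_natCast]
      congr 1
      have h1 := two_mul_choose_two k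
      rw [Nat.choose_succ_succ' (m + k) 1, Nat.choose_succ_succ' k 1, Nat.choose_succ_succ' m 1,
        choose_two_add m k, Nat.choose_one_right, Nat.choose_one_right, Nat.choose_one_right]
      zify at h1
      push_cast
      linear_combination -h1
    have s : (-1 : K) ^ m * (-1) ^ m = 1 := by rw [← mul_pow]; simp
    rw [pow_add (-1 : K)]
    simp only [div_eq_mul_inv, mul_inv]
    generalize a ^ (m + k) = A at *
    generalize a ^ (-((m + k : ℕ) : ℤ)) = A' at *
    linear_combination ((-1 : K) ^ k * qPoch q q (m + k) * (qPoch (q ^ 3) (q ^ 3) (m + k))⁻¹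
      * (qPoch (a * q) q (2 * (m + k)))⁻¹ * qPoch (a * q) q (m + k + m) *
      qPoch (a * q) q (2 * (m + k) + m) * (qPoch (a ^ 3 * q ^ 3) (q ^ 3) (m + k + m))⁻¹ *
      (qPoch q q m)⁻¹ * (qPoch q q k)⁻¹) * (((-1) ^ m * (-1) ^ m * A * A') * e2 +
        (A * A' * q ^ m * q ^ (k + 1).choose 2) * s + q ^ m * q ^ (k + 1).choose 2 * e1)

end Watson

/-! ### Base q⁴ with a square root of -1. -/

section Quartic

variable {K : Type*} [Field K] {i : K}

theorem quartic_factor (i x q : K) (n : ℕ) :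
    quadProd 1 (-(1 + i) * x) (i * x ^ 2) q n = qPoch (-x) q n * qPoch (-(i * x)) q n := by
  rw [qPoch, qPoch, quadProd, ← prod_mul_distrib]
  exact prod_congr rfl fun j _ => by ring

theorem quartic_denominator (hi : i ^ 2 = -1) (a q : K) (n s : ℕ) :
    qPoch (q ^ 4) (q ^ 4) (n - s) * qPoch (a ^ 4 * q ^ 4) (q ^ 4) (n + s) =
      (qPoch q q (n - s) * qPoch (i * q) q (n - s)) *
        (qPoch (a * q) q (n + s) * qPoch (a * i * q) q (n + s)) *
      (quadProd 1 (-(1 + i) * q) (i * q ^ 2) q (n - s) *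
        quadProd 1 (a * -(1 + i) * q) (a ^ 2 * i * q ^ 2) q (n + s)) := by
  rw [← mul_pow, qPoch_fourth hi, qPoch_fourth hi,
    show -(1 + i) * (a * q) = a * -(1 + i) * q by ring,
    show i * (a * q) ^ 2 = a ^ 2 * i * q ^ 2 by ring, show i * (a * q) = a * i * q by ring]
  ring

/-- The inner Bailey pair used for `e = 4`. -/
theorem baileyBeta_poisedAlpha_fourth (hi : i ^ 2 = -1) (a q : K) {m n : ℕ} (hm : m ≤ n)
    (hq : qPoch (q ^ 4) (q ^ 4) n ≠ 0) (ha : qPoch (a ^ 4 * q ^ 4) (q ^ 4) (2 * n) ≠ 0) :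
    baileyBeta a q (poisedAlpha a q (-(1 + i)) i n) m =
      qPoch (i * q) q n * qPoch q q n / (qPoch (q ^ 4) (q ^ 4) n * qPoch (i * a * q) q (2 * n)) *
        (qPoch (i * a * q) q (2 * n + m) / (qPoch q q m * qPoch (-(i * a * q)) q (n + m) *
          qPoch (-(a * q)) q (n + m))) := by
  have ham := qPoch_ne_zero_of_le ha (show n + m ≤ 2 * n by omega)
  rw [← mul_pow, qPoch_fourth hi] at ha ham
  rw [qPoch_fourth hi] at hq
  have e2 : ∀ m, quadProd 1 (a * -(1 + i) * q) (a ^ 2 * i * q ^ 2) q m =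
      quadProd 1 (-(1 + i) * (a * q)) (i * (a * q) ^ 2) q m := by
    intro m; congr 1 <;> ring
  have h1 := left_ne_zero_of_mul hq
  have h2 := left_ne_zero_of_mul ha
  have h3 := right_ne_zero_of_mul (left_ne_zero_of_mul ham)
  have h4 := right_ne_zero_of_mul ha
  have h5 := right_ne_zero_of_mul hq
  have h6 := left_ne_zero_of_mul h1
  have h7 := right_ne_zero_of_mul h1
  rw [baileyBeta_poisedAlpha a q (-(1 + i)) i hm (qPoch_ne_zero_of_le h6 hm)
    (qPoch_ne_zero_of_le (left_ne_zero_of_mul h2) (by omega)) h7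
    (by rw [e2]; exact h3), e2, qPoch_fourth hi,
    qPoch_add (i * a * q) q (2 * n) m,
    show a * i * q ^ (2 * n + 1) = i * a * q * q ^ (2 * n) by ring]
  rw [mul_assoc i a q]
  rw [quartic_factor i (a * q)] at h3 ⊢
  have h8 := left_ne_zero_of_mul h3
  have h9 := right_ne_zero_of_mul h3
  generalize quadProd 1 (-(1 + i) * q) (i * q ^ 2) q n = A at *
  generalize qPoch (i * (a * q)) q (2 * n) = B at *
  generalize qPoch (i * q) q n = C at *
  generalize qPoch (-(a * q)) q (n + m) = D at *
  generalize qPoch (-(i * (a * q))) q (n + m) = E at *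
  field_simp

theorem smpBeta_one_four_three (a q : K) (n : ℕ) (h : BetaDefined 4 a q n) (hi : i ^ 2 = -1) :
    smpBeta 1 4 3 a q n =
      qPoch (i * q) q n * qPoch q q n /
          (qPoch (q ^ 4) (q ^ 4) n * qPoch (i * a * q) q (2 * n) ^ 2) *
        ∑ r ∈ range (n + 1),
          a ^ r * q ^ (r ^ 2) * qPoch (i * a * q) q (2 * n + r) /
            (qPoch q q r * qPoch (-(i * a * q)) q (n + r) * qPoch (-(a * q)) q (n + r) *
              qPoch q q (n - r) * qPoch (i * q) q (n - r)) := by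
  obtain ⟨hq, ha⟩ := h
  have hi4 : i ^ 4 = 1 := by linear_combination (i ^ 2 - 1) * hi
  -- The quadratic (1+x)(1+ix) is already stored in `poisedAlpha`. The linear choice y = i, z = 0
  -- supplies the missing factor 1-ix, and a second weight.
  have key := sum_change_of_base a q i 0 (poisedAlpha a q (-(1 + i)) i n) n
    (qPoch_ne_zero_of_pow hq rfl) (qPoch_ne_zero_of_pow ha (mul_pow a q 4))
    (by
      rw [zero_mul, quadProd_eq_qPoch]
      exact qPoch_ne_zero_of_pow hq (by rw [mul_pow, hi4, one_mul]))
    (by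
      rw [mul_zero, zero_mul, quadProd_eq_qPoch]
      exact qPoch_ne_zero_of_pow ha (by rw [mul_pow, mul_pow, hi4, mul_one]))
  simp only [mul_zero, zero_mul, quadProd_eq_qPoch, qPoch_zero_left, mul_one] at key
  rw [smpBeta, smpAlpha_one 4 2 a q, baileyBeta]
  convert key using 1
  · refine sum_congr rfl fun s _ => ?_
    rw [quartic_denominator hi, poisedAlpha]
    simp only [div_eq_mul_inv, mul_inv]
    ring
  · rw [mul_sum, mul_sum]
    refine sum_congr rfl fun m hm => ?_
    rw [baileyBeta_poisedAlpha_fourth hi a q (Nat.lt_succ_iff.1 (mem_range.1 hm)) hq ha,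
      mul_comm a i]
    simp only [div_eq_mul_inv, mul_inv]
    ring

theorem smpBeta_one_four_two (a q : K) (hq0 : q ≠ 0) (n : ℕ) (h : BetaDefined 4 a q n)
    (hi : i ^ 2 = -1) :
    smpBeta 1 4 2 a q n =
      i ^ n * q ^ (n ^ 2) * qPoch (i * q) q n * qPoch q q n /
          (qPoch (q ^ 4) (q ^ 4) n * qPoch (i * a * q) q (2 * n) ^ 2) *
        ∑ r ∈ range (n + 1),
          (-i) ^ r * q ^ ((r : ℤ) ^ 2 - 2 * n * r) * qPoch (i * a * q) q (2 * n + r) /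
            (qPoch q q r * qPoch (-(i * a * q)) q (n + r) * qPoch (-(a * q)) q (n + r) *
              qPoch q q (n - r) * qPoch (i * q) q (n - r)) := by
  obtain ⟨hq, ha⟩ := h
  have hi4 : i ^ 4 = 1 := by linear_combination (i ^ 2 - 1) * hi
  -- The dual step supplies the same factor 1-ix without a weight, which lowers k by one.
  have key := sum_change_of_base_dual a q i hq0 (poisedAlpha a q (-(1 + i)) i n) n
    (qPoch_ne_zero_of_pow hq rfl) (qPoch_ne_zero_of_pow ha (mul_pow a q 4))
    (qPoch_ne_zero_of_pow hq (by rw [mul_pow, hi4, one_mul]))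
    (qPoch_ne_zero_of_pow ha (by rw [mul_pow, mul_pow, hi4, mul_one]))
  rw [smpBeta, smpAlpha_one 4 1 a q, baileyBeta]
  convert key using 1
  · refine sum_congr rfl fun s _ => ?_
    rw [quartic_denominator hi, poisedAlpha]
    simp only [div_eq_mul_inv, mul_inv]
    ring
  · rw [mul_sum, mul_sum]
    refine sum_congr rfl fun m hm => ?_
    rw [baileyBeta_poisedAlpha_fourth hi a q (Nat.lt_succ_iff.1 (mem_range.1 hm)) hq ha,
      mul_comm a i]
    obtain ⟨k, rfl⟩ := Nat.exists_eq_add_of_le (Nat.lt_succ_iff.1 (mem_range.1 hm))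
    rw [Nat.add_sub_cancel_left]
    have e : q ^ ((m + k) ^ 2) * q ^ ((m : ℤ) ^ 2 - 2 * (m + k : ℕ) * m) = q ^ (k ^ 2) := by
      rw [← zpow_natCast, ← zpow_add₀ hq0, ← zpow_natCast]
      congr 1
      push_cast
      ring
    have s : i ^ m * (-i) ^ m = 1 := by
      rw [← mul_pow, mul_neg, ← sq, hi, neg_neg, one_pow]
    rw [← e, pow_add i]
    simp only [div_eq_mul_inv, mul_inv]
    linear_combination (i ^ k * q ^ ((m + k) ^ 2) * q ^ ((m : ℤ) ^ 2 - 2 * (m + k : ℕ) * m) *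
      qPoch (i * q) q (m + k) * qPoch q q (m + k) * (qPoch (q ^ 4) (q ^ 4) (m + k))⁻¹ *
      (qPoch (i * a * q) q (2 * (m + k)) ^ 2)⁻¹ * qPoch (i * a * q) q (2 * (m + k) + m) *
      (qPoch q q m)⁻¹ * (qPoch (-(i * a * q)) q (m + k + m))⁻¹ *
      (qPoch (-(a * q)) q (m + k + m))⁻¹ * (qPoch q q k)⁻¹ * (qPoch (i * q) q k)⁻¹) * s

end Quartic

/-! ### Sequences supported on multiples of d. -/

section Dilation

variable {K : Type*} [Field K]

/-- `α` spread out to the multiples of `d`. -/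
def dilate (d : ℕ) (α : ℕ → K) (s : ℕ) : K := if d ∣ s then α (s / d) else 0

theorem sum_dilate {d : ℕ} (hd : 0 < d) (α f : ℕ → K) (n : ℕ) :
    ∑ s ∈ range (n + 1), dilate d α s * f s = ∑ r ∈ range (n / d + 1), α r * f (d * r) := by
  simp only [dilate, ite_mul, zero_mul]
  rw [← sum_filter]
  symm
  refine sum_nbij' (fun r => d * r) (fun s => s / d) ?_ ?_ ?_ ?_ ?_
  · intro r hr
    simp only [mem_filter, mem_range, Nat.lt_succ_iff] at hr ⊢
    exact ⟨(Nat.mul_le_mul_left d hr).trans (Nat.mul_div_le n d), dvd_mul_right d r⟩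
  · intro s hs
    simp only [mem_filter, mem_range, Nat.lt_succ_iff] at hs ⊢
    exact Nat.div_le_div_right hs.1
  · intro r _
    exact Nat.mul_div_cancel_left r hd
  · intro s hs
    exact Nat.mul_div_cancel' (mem_filter.1 hs).2
  · intro r _
    rw [Nat.mul_div_cancel_left r hd]

theorem baileyBeta_dilate {d : ℕ} (hd : 0 < d) (a q : K) (α : ℕ → K) (n : ℕ) :
    baileyBeta a q (dilate d α) n = ∑ r ∈ range (n / d + 1),
      α r / (qPoch q q (n - d * r) * qPoch (a * q) q (n + d * r)) := by
  simp only [baileyBeta, div_eq_mul_inv]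
  exact sum_dilate hd α (fun s => (qPoch q q (n - s) * qPoch (a * q) q (n + s))⁻¹) n

theorem mul_dilate {d : ℕ} (w α : ℕ → K) :
    (fun s => w s * dilate d α s) = dilate d fun r => w (d * r) * α r := by
  funext s
  unfold dilate
  split_ifs with h
  · simp only [Nat.mul_div_cancel' h]
  · rw [mul_zero]

theorem dilate_two_dilate_two (α : ℕ → K) : dilate 2 (dilate 2 α) = dilate 4 α := by
  funext s
  unfold dilate
  by_cases h4 : 4 ∣ s
  · rw [if_pos h4, if_pos (by omega), if_pos (by omega), Nat.div_div_eq_div_mul]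
  · rw [if_neg h4]
    split_ifs with h h'
    · omega
    · rfl
    · rfl

/-- Writing the third index as d+k makes all exponents natural numbers and exhibits α as a weighted
unit α in base q^d. -/
theorem smpAlpha_eq_dilate (d e k : ℕ) (a q : K) :
    smpAlpha d e (d + k) a q =
      dilate d fun r => a ^ (k * r) * q ^ (d * k * r ^ 2) * unitAlpha a (q ^ d) r := by
  funext s
  unfold dilate smpAlpha
  split_ifs with h
  · generalize s / d = r
    rw [show (((d + k : ℕ) : ℤ) - d) * (r : ℤ) = ((k * r : ℕ) : ℤ) by push_cast; ring,
      show (d : ℤ) * (((d + k : ℕ) : ℤ) - d) * (r : ℤ) ^ 2 + (d : ℤ) * ((r.choose 2 : ℕ) : ℤ) =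
        ((d * k * r ^ 2 + d * r.choose 2 : ℕ) : ℤ) by push_cast; ring, zpow_natCast, zpow_natCast,
      pow_add, pow_mul q d (r.choose 2)]
    simp only [unitAlpha]
    ring
  · rfl

theorem qPoch_pow_ne_zero {a q : K} {N d k : ℕ} (hd : 0 < d) (h : qPoch (a * q) q N ≠ 0)
    (hk : d * k ≤ N) : qPoch (a * q ^ d) (q ^ d) k ≠ 0 := by
  rw [qPoch_ne_zero_iff] at h ⊢
  intro j hj
  have h1 : d * (j + 1) ≤ d * k := Nat.mul_le_mul_left d hj
  rw [Nat.mul_succ] at h1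
  -- Factor j in base q^d is 1 - aq^{d(j+1)}, which is factor dj+d-1 of (aq;q)_N.
  have := h (d * j + d - 1) (by omega)
  rwa [mul_assoc, ← pow_succ', Nat.sub_add_cancel (by omega), pow_add, mul_comm (q ^ (d * j)),
    ← mul_assoc, pow_mul] at this

theorem qPoch_pow_self_ne_zero {q : K} {N d k : ℕ} (hd : 0 < d) (h : qPoch q q N ≠ 0)
    (hk : d * k ≤ N) : qPoch (q ^ d) (q ^ d) k ≠ 0 := by
  have := qPoch_pow_ne_zero (a := (1 : K)) (q := q) (N := N) hd (by rwa [one_mul]) hk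
  rwa [one_mul] at this

theorem qPoch_double (a q : K) (n : ℕ) :
    qPoch a q (2 * n) = qPoch a (q ^ 2) n * qPoch (a * q) (q ^ 2) n := by
  induction n with
  | zero => simp
  | succ n ih => rw [Nat.mul_succ, qPoch_succ, qPoch_succ, ih, qPoch_succ, qPoch_succ]; ring

end Dilation

/-! ### Finite sums behind the passage from base q² to base q. -/

section Doubling

variable {K : Type*} [Field K]

/-- The closed form satisfies a recurrence mixing a and aq². The freedom in u, v lets the same
computation serve both the sum and its dual, which split 1 - aq^{2n+3} differently. -/
theorem doubling_sum_rec {a q : K} {n : ℕ} (hq : qPoch q q (n + 2) ≠ 0)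
    (ha : qPoch (a * q) q (n + 2) ≠ 0) (u v : K) (huv : 1 - a * q * (q ^ 2) ^ (n + 1) =
      u * (1 - a * q * q ^ (n + 1)) + v * (1 - q * q ^ n)) :
    (1 - q * q ^ (n + 1)) * (qPoch (a * q) (q ^ 2) (n + 2) /
        (qPoch q q (n + 2) * qPoch (a * q) q (n + 2))) =
      u * (qPoch (a * q) (q ^ 2) (n + 1) / (qPoch q q (n + 1) * qPoch (a * q) q (n + 1))) +
      v / (1 - a * q ^ 2) * (qPoch (a * q ^ 2 * q) (q ^ 2) n /
        (qPoch q q n * qPoch (a * q ^ 2 * q) q n)) := by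
  have e1 : 1 - q * q ^ (n + 1) ≠ 0 := qPoch_ne_zero_iff.1 hq _ (by omega)
  have e2 : 1 - q * q ^ n ≠ 0 := qPoch_ne_zero_iff.1 hq _ (by omega)
  have e3 : 1 - a * q * q ^ 1 ≠ 0 := qPoch_ne_zero_iff.1 ha _ (by omega)
  have e4 : 1 - a * q * q ^ (n + 1) ≠ 0 := qPoch_ne_zero_iff.1 ha _ (by omega)
  have e5 : 1 - a * q * q ^ 0 ≠ 0 := qPoch_ne_zero_iff.1 ha _ (by omega)
  rw [pow_zero, mul_one] at e5
  have hs : a * q ^ 2 * q = a * q * q ^ 2 := by ring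
  have ha2 : qPoch (a * q ^ 2 * q) q n ≠ 0 := by
    rw [hs]; exact qPoch_shift_ne_zero ha (by omega)
  have hq0 : qPoch q q n ≠ 0 := qPoch_ne_zero_of_le hq (by omega)
  have ha1 : qPoch (a * q) q (n + 1) ≠ 0 := qPoch_ne_zero_of_le ha (by omega)
  have hY : qPoch (a * q) q (n + 1) * (1 - a * q * q ^ (n + 1)) =
      (1 - a * q) * ((1 - a * q * q ^ 1) * qPoch (a * q ^ 2 * q) q n) := by
    rw [← qPoch_succ, qPoch_succ', qPoch_succ', pow_one, show a * q ^ 2 * q = a * q * q * q by ring]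
  have hX : qPoch (a * q) (q ^ 2) (n + 1) = (1 - a * q) * qPoch (a * q ^ 2 * q) (q ^ 2) n := by
    rw [qPoch_succ', hs]
  rw [qPoch_succ (a * q) (q ^ 2) (n + 1), qPoch_succ q q (n + 1), qPoch_succ q q n,
    qPoch_succ (a * q) q (n + 1), eq_div_of_mul_eq e4 hY, hX, huv,
    show 1 - a * q ^ 2 = 1 - a * q * q ^ 1 by ring]
  generalize 1 - a * q * q ^ 1 = w1 at *
  generalize 1 - a * q * q ^ (n + 1) = w2 at *
  generalize 1 - q * q ^ (n + 1) = w3 at *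
  generalize 1 - q * q ^ n = w4 at *
  generalize 1 - a * q = w5 at *
  generalize qPoch (a * q ^ 2 * q) q n = w6 at *
  field_simp

/-- `1 / (q;q)_{n-2r}`, read as `0` for `2r > n`. -/
def halfInv (q : K) (n r : ℕ) : K := if 2 * r ≤ n then 1 / qPoch q q (n - 2 * r) else 0

/-- `q^{binom(n-2r,2)} / (q;q)_{n-2r}`, read as `0` for `2r > n`. -/
def halfInvDual (q : K) (n r : ℕ) : K :=
  if 2 * r ≤ n then q ^ (n - 2 * r).choose 2 / qPoch q q (n - 2 * r) else 0

theorem halfInv_add_two (q : K) (n r : ℕ) : halfInv q (n + 2) (r + 1) = halfInv q n r := by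
  simp only [halfInv, show n + 2 - 2 * (r + 1) = n - 2 * r by omega,
    show 2 * (r + 1) ≤ n + 2 ↔ 2 * r ≤ n by omega]

theorem halfInvDual_add_two (q : K) (n r : ℕ) :
    halfInvDual q (n + 2) (r + 1) = halfInvDual q n r := by
  simp only [halfInvDual, show n + 2 - 2 * (r + 1) = n - 2 * r by omega,
    show 2 * (r + 1) ≤ n + 2 ↔ 2 * r ≤ n by omega]

/-- This removes the last factor of (q;q)_{n-2r}. At 2r = n the left factor vanishes, and for 2r > n
the zero convention applies, so no range condition on r is needed. -/
theorem halfInv_add_one {q : K} {n : ℕ} (hq : qPoch q q n ≠ 0) (r : ℕ) :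
    (q ^ (2 * r) - q ^ n) * halfInv q n r = q ^ (2 * r) * halfInv q (n + 1) (r + 1) := by
  unfold halfInv
  by_cases h : 2 * r + 1 ≤ n
  · obtain ⟨k, rfl⟩ := Nat.exists_eq_add_of_le h
    rw [if_pos (by omega), if_pos (by omega), show 2 * r + 1 + k - 2 * r = k + 1 by omega,
      show 2 * r + 1 + k + 1 - 2 * (r + 1) = k by omega, qPoch_succ]
    have f := qPoch_ne_zero_of_le hq (show k + 1 ≤ 2 * r + 1 + k by omega)
    rw [qPoch_succ] at f
    have f1 := left_ne_zero_of_mul f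
    have f2 := right_ne_zero_of_mul f
    rw [show q ^ (2 * r) - q ^ (2 * r + 1 + k) = q ^ (2 * r) * (1 - q * q ^ k) by ring]
    generalize 1 - q * q ^ k = w at *
    field_simp
  · rw [if_neg (show ¬ 2 * (r + 1) ≤ n + 1 by omega), mul_zero]
    split_ifs with h'
    · rw [show n = 2 * r by omega, sub_self, zero_mul]
    · rw [mul_zero]

theorem halfInvDual_add_one {q : K} {n : ℕ} (hq : qPoch q q n ≠ 0) (r : ℕ) :
    q * (q ^ (2 * r) - q ^ n) * halfInvDual q n r = q ^ n * halfInvDual q (n + 1) (r + 1) := by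
  unfold halfInvDual
  by_cases h : 2 * r + 1 ≤ n
  · obtain ⟨k, rfl⟩ := Nat.exists_eq_add_of_le h
    rw [if_pos (by omega), if_pos (by omega), show 2 * r + 1 + k - 2 * r = k + 1 by omega,
      show 2 * r + 1 + k + 1 - 2 * (r + 1) = k by omega, qPoch_succ, Nat.choose_succ_succ' k 1,
      Nat.choose_one_right]
    have f := qPoch_ne_zero_of_le hq (show k + 1 ≤ 2 * r + 1 + k by omega)
    rw [qPoch_succ] at f
    have f1 := left_ne_zero_of_mul f
    have f2 := right_ne_zero_of_mul f
    rw [show q ^ (2 * r) - q ^ (2 * r + 1 + k) = q ^ (2 * r) * (1 - q * q ^ k) by ring]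
    generalize 1 - q * q ^ k = w at *
    field_simp
    ring
  · rw [if_neg (show ¬ 2 * (r + 1) ≤ n + 1 by omega), mul_zero]
    split_ifs with h'
    · rw [show n = 2 * r by omega, sub_self, mul_zero, zero_mul]
    · rw [mul_zero]

theorem sum_halfInv (q : K) (n : ℕ) (f : ℕ → K) :
    ∑ r ∈ range (n / 2 + 1), f r / qPoch q q (n - 2 * r) =
      ∑ r ∈ range (n / 2 + 1), f r * halfInv q n r := by
  refine sum_congr rfl fun r hr => ?_
  have := mem_range.1 hr
  rw [halfInv, if_pos (by omega), mul_one_div]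

theorem sum_halfInvDual (q : K) (n : ℕ) (f : ℕ → K) :
    ∑ r ∈ range (n / 2 + 1), f r * q ^ (n - 2 * r).choose 2 / qPoch q q (n - 2 * r) =
      ∑ r ∈ range (n / 2 + 1), f r * halfInvDual q n r := by
  refine sum_congr rfl fun r hr => ?_
  have := mem_range.1 hr
  rw [halfInvDual, if_pos (by omega), mul_div_assoc]

/-- Both sides obey the same two-step recurrence. The upper limit N is arbitrary beyond n/2, so that
the sums for n, n+1 and n+2 can be compared over matching ranges. -/
theorem doubling_sum_aux (q : K) (n : ℕ) : ∀ (a : K), qPoch q q n ≠ 0 → qPoch (a * q) q n ≠ 0 →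
    ∀ N, n / 2 < N → ∑ r ∈ range N, a ^ r * q ^ (2 * r ^ 2) /
      (qPoch (q ^ 2) (q ^ 2) r * qPoch (a * q ^ 2) (q ^ 2) r) * halfInv q n r =
      qPoch (a * q) (q ^ 2) n / (qPoch q q n * qPoch (a * q) q n) := by
  induction n using Nat.twoStepInduction with
  | zero =>
    intro a _ _ N hN
    rw [sum_eq_single_of_mem 0 (mem_range.2 hN)]
    · simp [halfInv]
    · intro r _ hr
      rw [halfInv, if_neg (by omega), mul_zero]
  | one =>
    intro a _ ha N hN
    rw [sum_eq_single_of_mem 0 (mem_range.2 (by omega))]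
    · simp only [qPoch, range_one, prod_singleton, pow_zero, mul_one] at ha ⊢
      simp only [halfInv, qPoch, pow_zero, mul_zero, Nat.sub_zero, range_one, range_zero,
        prod_singleton, prod_empty, mul_one, zero_pow two_ne_zero, zero_le, if_true]
      rw [div_mul_cancel_right₀ ha, one_div_one, one_mul, one_div]
    · intro r _ hr
      rw [halfInv, if_neg (by omega), mul_zero]
  | more n ih0 ih1 =>
    intro a hq ha N hN
    obtain ⟨N, rfl⟩ : ∃ M, N = M + 1 := ⟨N - 1, by omega⟩
    have e1 : 1 - q * q ^ (n + 1) ≠ 0 := qPoch_ne_zero_iff.1 hq _ (by omega)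
    have hs : a * q ^ 2 * q = a * q * q ^ 2 := by ring
    have ha2 : qPoch (a * q ^ 2 * q) q n ≠ 0 := by
      rw [hs]; exact qPoch_shift_ne_zero ha (by omega)
    have i1 := ih1 a (qPoch_ne_zero_of_le hq (by omega)) (qPoch_ne_zero_of_le ha (by omega))
      (N + 1) (by omega)
    have i0 := ih0 (a * q ^ 2) (qPoch_ne_zero_of_le hq (by omega)) ha2 N (by omega)
    apply mul_left_cancel₀ e1
    -- Termwise the recurrence is 1-q^{n+2} = (1-q^{n-2r}) + q^{n-2r}(1-q^{2r+2}), applied to the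
    -- term of index r+1.
    rw [doubling_sum_rec hq ha 1 (a * q ^ (n + 2)) (by ring), ← i0, ← i1, one_mul, sum_range_succ',
      sum_range_succ' _ N, mul_add, mul_sum, mul_sum, add_right_comm, ← sum_add_distrib]
    congr 1
    · refine sum_congr rfl fun r _ => ?_
      by_cases h0 : 2 * r ≤ n
      · have f3 : qPoch (q ^ 2) (q ^ 2) (r + 1) ≠ 0 :=
          qPoch_pow_self_ne_zero two_pos hq (by omega)
        rw [qPoch_succ] at f3
        have f5 : qPoch (a * q ^ 2) (q ^ 2) (r + 1) ≠ 0 :=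
          qPoch_pow_ne_zero two_pos ha (by omega)
        rw [qPoch_succ'] at f5
        have h := halfInv_add_one (qPoch_ne_zero_of_le hq (show n ≤ n + 2 by omega)) r
        rw [qPoch_succ' (a * q ^ 2) (q ^ 2) r, qPoch_succ (q ^ 2) (q ^ 2) r, halfInv_add_two]
        have f6 := left_ne_zero_of_mul f3
        have f7 := right_ne_zero_of_mul f3
        have f8 := left_ne_zero_of_mul f5
        have f9 := right_ne_zero_of_mul f5
        have hr : q ^ 2 * (q ^ 2) ^ r = q ^ 2 * q ^ (2 * r) := by ring
        rw [hr] at f7 ⊢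
        rw [show q ^ (2 * (r + 1) ^ 2) = q ^ 2 * q ^ (2 * r ^ 2) * q ^ (2 * r) * q ^ (2 * r) by ring,
          mul_pow, ← pow_mul]
        have hw := mul_inv_cancel₀ f7
        generalize qPoch (q ^ 2) (q ^ 2) r = D at *
        generalize qPoch (a * q ^ 2 * q ^ 2) (q ^ 2) r = A at *
        simp only [div_eq_mul_inv, mul_inv]
        linear_combination (a ^ (r + 1) * q ^ (2 * r ^ 2) * D⁻¹ * (1 - a * q ^ 2)⁻¹ * A⁻¹) *
          ((1 - q ^ 2 * q ^ (2 * r))⁻¹ * q ^ 2 * q ^ (2 * r) * h +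
            q ^ (n + 2) * q ^ (2 * r) * halfInv q n r * hw)
      · have h2 : halfInv q n r = 0 := if_neg h0
        have h1 : halfInv q (n + 1) (r + 1) = 0 := if_neg (by omega)
        rw [halfInv_add_two, h1, h2]
        simp
    · simp only [halfInv, mul_zero, Nat.sub_zero, zero_le, if_true]
      rw [qPoch_succ]
      have := qPoch_ne_zero_of_le hq (show n + 1 ≤ n + 2 by omega)
      generalize 1 - q * q ^ (n + 1) = w at *
      field_simp

theorem doubling_sum_dual_aux (q : K) (n : ℕ) : ∀ (a : K), qPoch q q n ≠ 0 → qPoch (a * q) q n ≠ 0 →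
    ∀ N, n / 2 < N → ∑ r ∈ range N, 1 /
      (qPoch (q ^ 2) (q ^ 2) r * qPoch (a * q ^ 2) (q ^ 2) r) * halfInvDual q n r =
      qPoch (a * q) (q ^ 2) n / (qPoch q q n * qPoch (a * q) q n) := by
  induction n using Nat.twoStepInduction with
  | zero =>
    intro a _ _ N hN
    rw [sum_eq_single_of_mem 0 (mem_range.2 hN)]
    · simp [halfInvDual]
    · intro r _ hr
      rw [halfInvDual, if_neg (by omega), mul_zero]
  | one =>
    intro a _ ha N hN
    rw [sum_eq_single_of_mem 0 (mem_range.2 (by omega))]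
    · simp only [qPoch, range_one, prod_singleton, pow_zero, mul_one] at ha ⊢
      simp only [halfInvDual, qPoch, pow_zero, mul_zero, Nat.sub_zero, range_one, range_zero,
        prod_singleton, prod_empty, mul_one, zero_le, if_true]
      rw [div_mul_cancel_right₀ ha, one_div_one, one_mul]
      simp
    · intro r _ hr
      rw [halfInvDual, if_neg (by omega), mul_zero]
  | more n ih0 ih1 =>
    intro a hq ha N hN
    obtain ⟨N, rfl⟩ : ∃ M, N = M + 1 := ⟨N - 1, by omega⟩
    have e1 : 1 - q * q ^ (n + 1) ≠ 0 := qPoch_ne_zero_iff.1 hq _ (by omega)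
    have hs : a * q ^ 2 * q = a * q * q ^ 2 := by ring
    have ha2 : qPoch (a * q ^ 2 * q) q n ≠ 0 := by
      rw [hs]; exact qPoch_shift_ne_zero ha (by omega)
    have i1 := ih1 a (qPoch_ne_zero_of_le hq (by omega)) (qPoch_ne_zero_of_le ha (by omega))
      (N + 1) (by omega)
    have i0 := ih0 (a * q ^ 2) (qPoch_ne_zero_of_le hq (by omega)) ha2 N (by omega)
    apply mul_left_cancel₀ e1
    -- The dual splitting is 1-q^{n+2} = (q^{2r+2}-q^{n+2}) + (1-q^{2r+2}).
    rw [doubling_sum_rec hq ha (q ^ (n + 1)) 1 (by ring), ← i0, ← i1, sum_range_succ',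
      sum_range_succ' _ N, mul_add, mul_add, mul_sum, mul_sum, mul_sum, add_right_comm, ← sum_add_distrib]
    congr 1
    · refine sum_congr rfl fun r _ => ?_
      by_cases h0 : 2 * r ≤ n
      · have f3 : qPoch (q ^ 2) (q ^ 2) (r + 1) ≠ 0 :=
          qPoch_pow_self_ne_zero two_pos hq (by omega)
        rw [qPoch_succ] at f3
        have f5 : qPoch (a * q ^ 2) (q ^ 2) (r + 1) ≠ 0 :=
          qPoch_pow_ne_zero two_pos ha (by omega)
        rw [qPoch_succ'] at f5
        have h := halfInvDual_add_one (qPoch_ne_zero_of_le hq (show n ≤ n + 2 by omega)) r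
        rw [qPoch_succ' (a * q ^ 2) (q ^ 2) r, qPoch_succ (q ^ 2) (q ^ 2) r, halfInvDual_add_two]
        have f6 := left_ne_zero_of_mul f3
        have f7 := right_ne_zero_of_mul f3
        have f8 := left_ne_zero_of_mul f5
        have f9 := right_ne_zero_of_mul f5
        have hr : q ^ 2 * (q ^ 2) ^ r = q ^ 2 * q ^ (2 * r) := by ring
        rw [hr] at f7 ⊢
        have hw := mul_inv_cancel₀ f7
        generalize qPoch (q ^ 2) (q ^ 2) r = D at *
        generalize qPoch (a * q ^ 2 * q ^ 2) (q ^ 2) r = A at *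
        simp only [div_eq_mul_inv, mul_inv]
        linear_combination (D⁻¹ * (1 - a * q ^ 2)⁻¹ * A⁻¹) *
          ((1 - q ^ 2 * q ^ (2 * r))⁻¹ * q * h + halfInvDual q n r * hw)
      · have h2 : halfInvDual q n r = 0 := if_neg h0
        have h1 : halfInvDual q (n + 1) (r + 1) = 0 := if_neg (by omega)
        rw [halfInvDual_add_two, h1, h2]
        simp
    · simp only [halfInvDual, mul_zero, Nat.sub_zero, zero_le, if_true]
      rw [qPoch_succ]
      have := qPoch_ne_zero_of_le hq (show n + 1 ≤ n + 2 by omega)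
      generalize 1 - q * q ^ (n + 1) = w at *
      rw [Nat.choose_succ_succ' (n + 1) 1, Nat.choose_one_right, pow_add]
      field_simp

/-- This is the coefficient of x^n in (x²;q²)_∞/(x;q)_∞ = (-x;q)_∞. The proof stays finite, through
the recurrence `hrec`. -/
theorem signed_sum_aux (q : K) (n : ℕ) : qPoch q q n ≠ 0 →
    ∀ N, n / 2 < N → ∑ r ∈ range N, (-1) ^ r * q ^ (2 * r.choose 2) / qPoch (q ^ 2) (q ^ 2) r *
      halfInv q n r = q ^ n.choose 2 / qPoch q q n := by
  induction n using Nat.twoStepInduction with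
  | zero =>
    intro _ N hN
    rw [sum_eq_single_of_mem 0 (mem_range.2 hN)]
    · simp [halfInv]
    · intro r _ hr
      rw [halfInv, if_neg (by omega), mul_zero]
  | one =>
    intro _ N hN
    rw [sum_eq_single_of_mem 0 (mem_range.2 (by omega))]
    · simp [halfInv]
    · intro r _ hr
      rw [halfInv, if_neg (by omega), mul_zero]
  | more n ih0 ih1 =>
    intro hq N hN
    obtain ⟨N, rfl⟩ : ∃ M, N = M + 1 := ⟨N - 1, by omega⟩
    have e1 : 1 - q * q ^ (n + 1) ≠ 0 := qPoch_ne_zero_iff.1 hq _ (by omega)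
    have e2 : 1 - q * q ^ n ≠ 0 := qPoch_ne_zero_iff.1 hq _ (by omega)
    have hq0 := qPoch_ne_zero_of_le hq (show n ≤ n + 2 by omega)
    have i1 := ih1 (qPoch_ne_zero_of_le hq (by omega)) (N + 1) (by omega)
    have i0 := ih0 hq0 N (by omega)
    have hrec : (1 - q * q ^ (n + 1)) * (q ^ (n + 2).choose 2 / qPoch q q (n + 2)) =
        q ^ (n + 1).choose 2 / qPoch q q (n + 1) + -q ^ n * (q ^ n.choose 2 / qPoch q q n) := by
      rw [qPoch_succ q q (n + 1), qPoch_succ q q n, Nat.choose_succ_succ' (n + 1) 1,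
        Nat.choose_succ_succ' n 1, Nat.choose_one_right, Nat.choose_one_right]
      have hw : 1 - q * q ^ n = 1 - q ^ (n + 1) := by ring
      obtain ⟨w, h⟩ : ∃ w, w = 1 - q * q ^ n := ⟨_, rfl⟩
      rw [← h] at e2 ⊢
      generalize 1 - q * q ^ (n + 1) = v at *
      field_simp
      rw [h]
      ring
    apply mul_left_cancel₀ e1
    rw [hrec, ← i0, ← i1, sum_range_succ', sum_range_succ' _ N, mul_add, mul_sum, mul_sum,
      add_right_comm, ← sum_add_distrib]
    congr 1
    · refine sum_congr rfl fun r _ => ?_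
      by_cases h0 : 2 * r ≤ n
      · have f3 : qPoch (q ^ 2) (q ^ 2) (r + 1) ≠ 0 :=
          qPoch_pow_self_ne_zero two_pos hq (by omega)
        rw [qPoch_succ] at f3
        have h := halfInv_add_one hq0 r
        rw [qPoch_succ (q ^ 2) (q ^ 2) r, halfInv_add_two]
        have f6 := left_ne_zero_of_mul f3
        have f7 := right_ne_zero_of_mul f3
        have hr : q ^ 2 * (q ^ 2) ^ r = q ^ 2 * q ^ (2 * r) := by ring
        rw [hr] at f7 ⊢
        rw [Nat.choose_succ_succ' r 1, Nat.choose_one_right, mul_add, pow_add q (2 * r)]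
        have hw := mul_inv_cancel₀ f7
        generalize qPoch (q ^ 2) (q ^ 2) r = D at *
        simp only [div_eq_mul_inv, mul_inv]
        linear_combination ((-1) ^ (r + 1) * q ^ (2 * r.choose 2) * D⁻¹) *
          ((1 - q ^ 2 * q ^ (2 * r))⁻¹ * h + q ^ n * halfInv q n r * hw)
      · have h2 : halfInv q n r = 0 := if_neg h0
        have h1 : halfInv q (n + 1) (r + 1) = 0 := if_neg (by omega)
        rw [halfInv_add_two, h1, h2]
        simp
    · simp only [halfInv, mul_zero, Nat.sub_zero, zero_le, if_true]
      rw [qPoch_succ]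
      have := qPoch_ne_zero_of_le hq (show n + 1 ≤ n + 2 by omega)
      generalize 1 - q * q ^ (n + 1) = w at *
      field_simp

end Doubling

/-! ### Doubling the support of α, and its consequences for d = 2 and d = 4. -/

section DoublingTransformation

variable {K : Type*} [Field K]

theorem halfInv_add (q : K) (s k m : ℕ) : halfInv q (2 * s + k) (s + m) = halfInv q k m := by
  simp only [halfInv, show 2 * s + k - 2 * (s + m) = k - 2 * m by omega,
    show 2 * (s + m) ≤ 2 * s + k ↔ 2 * m ≤ k by omega]

theorem halfInvDual_add (q : K) (s k m : ℕ) :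
    halfInvDual q (2 * s + k) (s + m) = halfInvDual q k m := by
  simp only [halfInvDual, show 2 * s + k - 2 * (s + m) = k - 2 * m by omega,
    show 2 * (s + m) ≤ 2 * s + k ↔ 2 * m ≤ k by omega]

theorem qPoch_odd_ne_zero {a q : K} {n : ℕ} (ha : qPoch (a * q) q (2 * n) ≠ 0) :
    qPoch (a * q) (q ^ 2) n ≠ 0 := by
  rw [qPoch_double] at ha
  exact left_ne_zero_of_mul ha

/-- The common evaluation behind `baileyBeta_double` and `baileyBeta_double_dual`. -/
theorem doubling_kernel {a q : K} {s k : ℕ} (ha : qPoch (a * q) q (2 * (2 * s + k)) ≠ 0) :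
    1 / qPoch (a * q ^ 2) (q ^ 2) (2 * s) * (qPoch (a * q ^ (4 * s) * q) (q ^ 2) k /
      (qPoch q q k * qPoch (a * q ^ (4 * s) * q) q k)) =
    qPoch (a * q) (q ^ 2) (2 * s + k) /
      (qPoch q q k * qPoch (a * q) q (2 * s + k + 2 * s)) := by
  have h1 : qPoch (a * q) q (2 * (2 * s)) ≠ 0 := qPoch_ne_zero_of_le ha (by omega)
  have h2 := qPoch_odd_ne_zero h1
  rw [show 2 * s + k + 2 * s = 2 * (2 * s) + k by ring, qPoch_add (a * q) q,
    qPoch_add (a * q) (q ^ 2), qPoch_double (a * q) q (2 * s),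
    show a * q * (q ^ 2) ^ (2 * s) = a * q ^ (4 * s) * q by ring,
    show a * q * q ^ (2 * (2 * s)) = a * q ^ (4 * s) * q by ring,
    show a * q ^ 2 = a * q * q by ring]
  generalize qPoch (a * q) (q ^ 2) (2 * s) = A at *
  simp only [div_eq_mul_inv, mul_inv]
  linear_combination (-(qPoch (a * q * q) (q ^ 2) (2 * s))⁻¹ *
    qPoch (a * q ^ (4 * s) * q) (q ^ 2) k * (qPoch q q k)⁻¹ *
    (qPoch (a * q ^ (4 * s) * q) q k)⁻¹) * mul_inv_cancel₀ h2

/-- Change of base `q² → q`, doubling the support of `α`. -/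
theorem baileyBeta_double (a q : K) (α : ℕ → K) (n : ℕ) (hq : qPoch q q n ≠ 0)
    (ha : qPoch (a * q) q (2 * n) ≠ 0) :
    baileyBeta a q (dilate 2 fun s => a ^ s * q ^ (2 * s ^ 2) * α s) n =
      1 / qPoch (a * q) (q ^ 2) n * ∑ r ∈ range (n / 2 + 1),
        a ^ r * q ^ (2 * r ^ 2) * baileyBeta a (q ^ 2) α r / qPoch q q (n - 2 * r) := by
  have key := sum_mul_baileyBeta a (q ^ 2) α (fun m => a ^ m * q ^ (2 * m ^ 2) * halfInv q n m)
    (fun s => a ^ s * q ^ (2 * s ^ 2) * (qPoch (a * q) (q ^ 2) n /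
      (qPoch q q (n - 2 * s) * qPoch (a * q) q (n + 2 * s)))) (n / 2) ?_
  · have h1 := qPoch_odd_ne_zero ha
    rw [sum_halfInv q n, baileyBeta_dilate two_pos]
    apply mul_left_cancel₀ h1
    rw [← mul_assoc, mul_one_div_cancel h1, one_mul]
    convert key.symm using 1
    · rw [mul_sum]
      refine sum_congr rfl fun s _ => ?_
      simp only [div_eq_mul_inv]
      ring
    · refine sum_congr rfl fun s _ => ?_
      ring
  · intro s hs
    obtain ⟨k, rfl⟩ := Nat.exists_eq_add_of_le (show 2 * s ≤ n by omega)
    have hs4 : a * q ^ (4 * s) * q = a * q * q ^ (4 * s) := by ring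
    -- The kernel at s is the doubling sum with a replaced by aq^{4s} and n by n-2s.
    have h := doubling_sum_aux q k (a * q ^ (4 * s)) (qPoch_ne_zero_of_le hq (by omega))
      (by rw [hs4]; exact qPoch_shift_ne_zero ha (by omega)) ((2 * s + k) / 2 - s + 1) (by omega)
    rw [Nat.add_sub_cancel_left, ← doubling_kernel ha, ← h, mul_sum, mul_sum]
    refine sum_congr rfl fun m _ => ?_
    rw [halfInv_add, show s + m + s = 2 * s + m by ring, qPoch_add (a * q ^ 2),
      show a * q ^ 2 * (q ^ 2) ^ (2 * s) = a * q ^ (4 * s) * q ^ 2 by ring]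
    simp only [div_eq_mul_inv, mul_inv]
    ring

/-- Change of base `q² → q`, doubling the support of `α`, dual form. -/
theorem baileyBeta_double_dual (a q : K) (α : ℕ → K) (n : ℕ) (hq : qPoch q q n ≠ 0)
    (ha : qPoch (a * q) q (2 * n) ≠ 0) :
    baileyBeta a q (dilate 2 α) n =
      1 / qPoch (a * q) (q ^ 2) n * ∑ r ∈ range (n / 2 + 1),
        baileyBeta a (q ^ 2) α r * q ^ (n - 2 * r).choose 2 / qPoch q q (n - 2 * r) := by
  have key := sum_mul_baileyBeta a (q ^ 2) α (fun m => halfInvDual q n m)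
    (fun s => qPoch (a * q) (q ^ 2) n /
      (qPoch q q (n - 2 * s) * qPoch (a * q) q (n + 2 * s))) (n / 2) ?_
  · have h1 := qPoch_odd_ne_zero ha
    rw [sum_halfInvDual q n, baileyBeta_dilate two_pos]
    apply mul_left_cancel₀ h1
    rw [← mul_assoc, mul_one_div_cancel h1, one_mul]
    convert key.symm using 1
    · rw [mul_sum]
      refine sum_congr rfl fun s _ => ?_
      simp only [div_eq_mul_inv]
      ring
    · refine sum_congr rfl fun s _ => ?_
      ring
  · intro s hs
    obtain ⟨k, rfl⟩ := Nat.exists_eq_add_of_le (show 2 * s ≤ n by omega)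
    have hs4 : a * q ^ (4 * s) * q = a * q * q ^ (4 * s) := by ring
    have h := doubling_sum_dual_aux q k (a * q ^ (4 * s)) (qPoch_ne_zero_of_le hq (by omega))
      (by rw [hs4]; exact qPoch_shift_ne_zero ha (by omega)) ((2 * s + k) / 2 - s + 1) (by omega)
    rw [Nat.add_sub_cancel_left, ← doubling_kernel ha, ← h, mul_sum]
    refine sum_congr rfl fun m _ => ?_
    rw [halfInvDual_add, show s + m + s = 2 * s + m by ring, qPoch_add (a * q ^ 2),
      show a * q ^ 2 * (q ^ 2) ^ (2 * s) = a * q ^ (4 * s) * q ^ 2 by ring]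
    simp only [div_eq_mul_inv, mul_inv]
    ring

theorem sum_div_mul_baileyBeta_unitAlpha {a q : K} {n : ℕ} (hq : qPoch q q n ≠ 0)
    (ha : qPoch (a * q) q (2 * n) ≠ 0) (c : ℕ → K) :
    ∑ m ∈ range (n / 2 + 1), c m * baileyBeta a (q ^ 2) (unitAlpha a (q ^ 2)) m = c 0 := by
  have h := qPoch_pow_ne_zero two_pos ha (show 2 * (2 * (n / 2)) ≤ 2 * n by omega)
  exact sum_mul_baileyBeta_unitAlpha a (q ^ 2) c (n / 2)
    (qPoch_pow_self_ne_zero two_pos hq (by omega)) h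

/-- The pair with `(d,e,k) = (2,1,3)`. -/
theorem baileyBeta_two_one_three (a q : K) (n : ℕ) (hq : qPoch q q n ≠ 0)
    (ha : qPoch (a * q) q (2 * n) ≠ 0) :
    baileyBeta a q (dilate 2 fun r => a ^ r * q ^ (2 * r ^ 2) * unitAlpha a (q ^ 2) r) n =
      1 / (qPoch q q n * qPoch (a * q) (q ^ 2) n) := by
  rw [baileyBeta_double a q _ n hq ha]
  have := sum_div_mul_baileyBeta_unitAlpha hq ha fun m => a ^ m * q ^ (2 * m ^ 2) /
    qPoch q q (n - 2 * m)
  simp only [div_mul_eq_mul_div] at this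
  rw [this]
  simp only [pow_zero, zero_pow two_ne_zero, mul_zero, Nat.sub_zero, one_div, mul_inv, mul_one]
  ring

/-- The pair with `(d,e,k) = (2,1,2)`. -/
theorem baileyBeta_two_one_two (a q : K) (n : ℕ) (hq : qPoch q q n ≠ 0)
    (ha : qPoch (a * q) q (2 * n) ≠ 0) :
    baileyBeta a q (dilate 2 (unitAlpha a (q ^ 2))) n =
      q ^ n.choose 2 / (qPoch q q n * qPoch (a * q) (q ^ 2) n) := by
  rw [baileyBeta_double_dual a q _ n hq ha]
  have := sum_div_mul_baileyBeta_unitAlpha hq ha fun m => q ^ (n - 2 * m).choose 2 /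
    qPoch q q (n - 2 * m)
  have e : ∀ m, baileyBeta a (q ^ 2) (unitAlpha a (q ^ 2)) m * q ^ (n - 2 * m).choose 2 /
      qPoch q q (n - 2 * m) = q ^ (n - 2 * m).choose 2 / qPoch q q (n - 2 * m) *
        baileyBeta a (q ^ 2) (unitAlpha a (q ^ 2)) m := fun m => by ring
  simp only [e]
  rw [this]
  simp only [mul_zero, Nat.sub_zero, div_eq_mul_inv, mul_inv]
  ring

theorem smpBeta_two_one_five (a q : K) (n : ℕ) (h : BetaDefined 1 a q n) :
    smpBeta 2 1 5 a q n = ∑ r ∈ range (n + 1),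
      a ^ r * q ^ (r ^ 2) / (qPoch q q r * qPoch (a * q) (q ^ 2) r * qPoch q q (n - r)) := by
  obtain ⟨hq, ha⟩ := h
  rw [smpBeta, smpAlpha_eq_dilate 2 1 3 a q]
  rw [pow_one, pow_one] at *
  have := baileyBeta_chain a q
    (dilate 2 fun r => a ^ r * q ^ (2 * r ^ 2) * unitAlpha a (q ^ 2) r) n hq ha
  rw [mul_dilate] at this
  convert this using 1
  · congr 2; funext r; ring
  · refine sum_congr rfl fun m hm => ?_
    have hm' := mem_range.1 hm
    rw [baileyBeta_two_one_three a q m (qPoch_ne_zero_of_le hq (by omega))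
      (qPoch_ne_zero_of_le ha (by omega))]
    simp only [div_eq_mul_inv, mul_inv]
    ring

theorem smpBeta_two_two_five (a q : K) (n : ℕ) (h : BetaDefined 2 a q n) :
    smpBeta 2 2 5 a q n = 1 / qPoch (-(a * q)) q (2 * n) * ∑ r ∈ range (n + 1),
      a ^ r * q ^ (r ^ 2) /
        (qPoch q q r * qPoch (a * q) (q ^ 2) r * qPoch (q ^ 2) (q ^ 2) (n - r)) := by
  obtain ⟨hq, ha⟩ := h
  rw [smpBeta, smpAlpha_eq_dilate 2 2 3 a q]
  have := baileyBeta_sq a q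
    (dilate 2 fun r => a ^ r * q ^ (2 * r ^ 2) * unitAlpha a (q ^ 2) r) n hq ha
  rw [mul_dilate] at this
  convert this using 1
  · congr 2; funext r; ring
  · congr 1
    refine sum_congr rfl fun m hm => ?_
    have hm' := mem_range.1 hm
    rw [baileyBeta_two_one_three a q m
      (qPoch_ne_zero_of_le (qPoch_ne_zero_of_pow hq rfl) (by omega))
      (qPoch_ne_zero_of_le (qPoch_ne_zero_of_pow ha (mul_pow a q 2)) (by omega))]
    simp only [div_eq_mul_inv, mul_inv]
    ring

theorem smpBeta_two_two_two (a q : K) (hq0 : q ≠ 0) (n : ℕ) (h : BetaDefined 2 a q n) :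
    smpBeta 2 2 2 a q n = (-1) ^ n * q ^ (n ^ 2) / qPoch (-(a * q)) q (2 * n) *
      ∑ r ∈ range (n + 1), (-1) ^ r * q ^ ((3 * (r : ℤ) ^ 2 - r) / 2 - 2 * n * r) /
        (qPoch (a * q) (q ^ 2) r * qPoch q q r * qPoch (q ^ 2) (q ^ 2) (n - r)) := by
  obtain ⟨hq, ha⟩ := h
  rw [smpBeta, smpAlpha_eq_dilate 2 2 0 a q]
  have := baileyBeta_sq_dual a q hq0 (dilate 2 (unitAlpha a (q ^ 2))) n hq ha
  convert this using 1
  · congr 2; funext r; simp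
  · rw [mul_sum, mul_sum]
    refine sum_congr rfl fun m hm => ?_
    have hm' := mem_range.1 hm
    rw [baileyBeta_two_one_two a q m
      (qPoch_ne_zero_of_le (qPoch_ne_zero_of_pow hq rfl) (by omega))
      (qPoch_ne_zero_of_le (qPoch_ne_zero_of_pow ha (mul_pow a q 2)) (by omega))]
    obtain ⟨k, rfl⟩ := Nat.exists_eq_add_of_le (Nat.lt_succ_iff.1 hm')
    rw [Nat.add_sub_cancel_left]
    -- The integer division is exact, since m² - m is even.
    have h2 : (3 * (m : ℤ) ^ 2 - m) / 2 = m ^ 2 + m.choose 2 := by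
      have := two_mul_choose_two m
      zify at this
      omega
    have e : q ^ ((m + k) ^ 2) * q ^ ((3 * (m : ℤ) ^ 2 - m) / 2 - 2 * (m + k : ℕ) * m) =
        q ^ (k ^ 2) * q ^ m.choose 2 := by
      rw [h2, ← zpow_natCast, ← zpow_add₀ hq0, ← pow_add, ← zpow_natCast]
      congr 1
      push_cast
      ring
    have s : (-1 : K) ^ m * (-1) ^ m = 1 := by rw [← mul_pow]; simp
    rw [pow_add (-1 : K)]
    simp only [div_eq_mul_inv, mul_inv]
    linear_combination (((-1) ^ m * (-1) ^ m) * (-1 : K) ^ k *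
      (qPoch (-(a * q)) q (2 * (m + k)))⁻¹ * (qPoch (a * q) (q ^ 2) m)⁻¹ * (qPoch q q m)⁻¹ *
      (qPoch (q ^ 2) (q ^ 2) k)⁻¹) * e + ((-1 : K) ^ k *
      (qPoch (-(a * q)) q (2 * (m + k)))⁻¹ * (qPoch (a * q) (q ^ 2) m)⁻¹ * (qPoch q q m)⁻¹ *
      (qPoch (q ^ 2) (q ^ 2) k)⁻¹ * (q ^ (k ^ 2) * q ^ m.choose 2)) * s

/-- Doubling is applied twice: the pair (2,1,3) in base q² is doubled again, moving the support to
multiples of 4. -/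
theorem smpBeta_four_one_seven (a q : K) (n : ℕ) (h : BetaDefined 1 a q n) :
    smpBeta 4 1 7 a q n = 1 / qPoch (a * q) (q ^ 2) n * ∑ r ∈ range (n / 2 + 1),
      a ^ r * q ^ (2 * r ^ 2) /
        (qPoch (q ^ 2) (q ^ 2) r * qPoch (a * q ^ 2) (q ^ 4) r * qPoch q q (n - 2 * r)) := by
  obtain ⟨hq, ha⟩ := h
  rw [smpBeta, smpAlpha_eq_dilate 4 1 3 a q]
  rw [pow_one, pow_one] at *
  have := baileyBeta_double a q (dilate 2 fun r => a ^ r * (q ^ 2) ^ (2 * r ^ 2) *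
    unitAlpha a ((q ^ 2) ^ 2) r) n hq ha
  rw [mul_dilate, dilate_two_dilate_two] at this
  convert this using 1
  · congr 2; funext r; ring_nf
  · congr 1
    refine sum_congr rfl fun m hm => ?_
    have hm' := mem_range.1 hm
    rw [baileyBeta_two_one_three a (q ^ 2) m (qPoch_pow_self_ne_zero two_pos hq (by omega))
      (qPoch_pow_ne_zero two_pos ha (by omega)), show (q ^ 2) ^ 2 = q ^ 4 by ring]
    simp only [div_eq_mul_inv, mul_inv]
    ring

end DoublingTransformation

/-! ### The formulas (2,2,3) and (2,2,4) via the q-binomial theorem. -/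

section BinomialParts

variable {K : Type*} [Field K]

/-- The finite `q`-binomial theorem. -/
theorem qBinomial_sum (x q : K) (n : ℕ) (hq : qPoch q q n ≠ 0) :
    ∑ m ∈ range (n + 1), x ^ m * q ^ (m + 1).choose 2 / (qPoch q q (n - m) * qPoch q q m) =
      qPoch (-(x * q)) q n / qPoch q q n := by
  have h := qSaalschutz_sum 0 q 1 0 (-x) n hq (by simp)
  have e1 : ∀ m, q ^ m * quadProd 0 (-x) 0 q m = x ^ m * q ^ (m + 1).choose 2 := by
    intro m
    rw [← quadProd_smul, mul_zero, mul_comm q, quadProd_linear, neg_neg]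
  have e2 : ∀ m, quadProd 1 0 0 q m = (1 : K) := by simp [quadProd]
  simpa [e1, e2, quadProd_eq_qPoch] using h

theorem sum_triangle_comm (n : ℕ) (f : ℕ → ℕ → K) :
    ∑ r ∈ range (n / 2 + 1), ∑ j ∈ range (n - 2 * r + 1), f r j =
      ∑ j ∈ range (n + 1), ∑ r ∈ range ((n - j) / 2 + 1), f r j := by
  apply sum_comm'
  intro r j
  simp only [mem_range]
  omega

theorem qPoch_full_factor (a q : K) (n : ℕ) :
    qPoch (a ^ 2 * q) q (2 * n) =
      qPoch (a ^ 2 * q) (q ^ 2) n * (qPoch (a * q) q n * qPoch (-(a * q)) q n) := by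
  rw [qPoch_double, ← qPoch_sq, show a ^ 2 * q * q = (a * q) ^ 2 by ring]

/-- Doubling the pair (1,2,1) puts (-aq;q)_{2r} in the denominator. Multiplying by (-aq;q)_n leaves
(-aq^{2r+1};q)_{n-2r}, which the q-binomial theorem expands; after interchanging sums, the sum over
r is `signed_sum_aux`. -/
theorem baileyBeta_double_four (a q : K) (hq0 : q ≠ 0) (n : ℕ) (hq : qPoch q q n ≠ 0)
    (ha : qPoch (a ^ 2 * q) q (2 * n) ≠ 0) :
    baileyBeta (a ^ 2) q
      (dilate 2 fun s => (a ^ 2) ^ s * q ^ (2 * s ^ 2) * unitAlpha a q s) n =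
      qPoch (a * q) q n / qPoch (a ^ 2 * q) q (2 * n) *
        ∑ r ∈ range (n + 1), a ^ r * q ^ (r ^ 2) / (qPoch q q r * qPoch q q (n - r)) := by
  rw [baileyBeta_double (a ^ 2) q _ n hq ha]
  have hf := ha
  rw [qPoch_full_factor] at hf ⊢
  have h1 := left_ne_zero_of_mul hf
  have h2 := left_ne_zero_of_mul (right_ne_zero_of_mul hf)
  have h3 := right_ne_zero_of_mul (right_ne_zero_of_mul hf)
  have key : ∑ r ∈ range (n / 2 + 1), (a ^ 2) ^ r * q ^ (2 * r ^ 2) *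
      baileyBeta (a ^ 2) (q ^ 2) (unitAlpha a q) r / qPoch q q (n - 2 * r) =
      1 / qPoch (-(a * q)) q n *
        ∑ r ∈ range (n + 1), a ^ r * q ^ (r ^ 2) / (qPoch q q r * qPoch q q (n - r)) := by
    rw [one_div, ← div_eq_inv_mul, eq_div_iff h3]
    have hterm : ∀ r ∈ range (n / 2 + 1), (a ^ 2) ^ r * q ^ (2 * r ^ 2) *
        baileyBeta (a ^ 2) (q ^ 2) (unitAlpha a q) r / qPoch q q (n - 2 * r) *
          qPoch (-(a * q)) q n = ∑ j ∈ range (n - 2 * r + 1),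
        (-1) ^ r * a ^ (2 * r) * q ^ (3 * r ^ 2) / qPoch (q ^ 2) (q ^ 2) r *
          ((a * q ^ (2 * r)) ^ (n - 2 * r - j) * q ^ (n - 2 * r - j + 1).choose 2 /
            (qPoch q q j * qPoch q q (n - 2 * r - j))) := by
      intro r hr
      have hr' := mem_range.1 hr
      have hb := qBinomial_sum (a * q ^ (2 * r)) q (n - 2 * r) (qPoch_ne_zero_of_le hq (by omega))
      -- After reversal the total power of a is n-j, independent of r, so the sum over r can be done
      -- for fixed j.
      rw [← sum_range_reflect] at hb
      have hb' : ∑ j ∈ range (n - 2 * r + 1), (a * q ^ (2 * r)) ^ (n - 2 * r - j) *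
          q ^ (n - 2 * r - j + 1).choose 2 / (qPoch q q j * qPoch q q (n - 2 * r - j)) =
          qPoch (-(a * q ^ (2 * r) * q)) q (n - 2 * r) / qPoch q q (n - 2 * r) := by
        rw [← hb]
        refine sum_congr rfl fun j hj => ?_
        have := mem_range.1 hj
        rw [show n - 2 * r + 1 - 1 - j = n - 2 * r - j by omega,
          show n - 2 * r - (n - 2 * r - j) = j by omega]
      rw [← mul_sum, hb', baileyBeta_one_two_one a q hq0 r
        (qPoch_pow_self_ne_zero two_pos hq (by omega))
        (qPoch_pow_ne_zero two_pos ha (by omega))]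
      have h4 : qPoch (-(a * q)) q n = qPoch (-(a * q)) q (2 * r) *
          qPoch (-(a * q ^ (2 * r) * q)) q (n - 2 * r) := by
        rw [show n = 2 * r + (n - 2 * r) by omega, qPoch_add, Nat.add_sub_cancel_left]
        congr 2; ring
      have h5 := qPoch_ne_zero_of_le h3 (show 2 * r ≤ n by omega)
      rw [h4]
      generalize qPoch (-(a * q)) q (2 * r) = A at *
      field_simp
      ring
    rw [sum_mul, sum_congr rfl hterm, sum_triangle_comm n fun r j =>
      (-1) ^ r * a ^ (2 * r) * q ^ (3 * r ^ 2) / qPoch (q ^ 2) (q ^ 2) r *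
          ((a * q ^ (2 * r)) ^ (n - 2 * r - j) * q ^ (n - 2 * r - j + 1).choose 2 /
            (qPoch q q j * qPoch q q (n - 2 * r - j)))]
    rw [← sum_range_reflect (fun r => a ^ r * q ^ (r ^ 2) / (qPoch q q r * qPoch q q (n - r)))]
    refine sum_congr rfl fun j hj => ?_
    obtain ⟨m, rfl⟩ := Nat.exists_eq_add_of_le (Nat.lt_succ_iff.1 (mem_range.1 hj))
    rw [show j + m + 1 - 1 - j = m by omega, show j + m - m = j by omega, Nat.add_sub_cancel_left]
    have hs := signed_sum_aux q m (qPoch_ne_zero_of_le hq (by omega)) (m / 2 + 1) (by omega)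
    have hm : q ^ (m ^ 2) = q ^ (m + 1).choose 2 * q ^ m.choose 2 := by
      rw [← pow_add, ← two_mul_choose_two m, Nat.choose_succ_succ' m 1, Nat.choose_one_right]
      congr 1; ring
    rw [hm, show a ^ m * (q ^ (m + 1).choose 2 * q ^ m.choose 2) / (qPoch q q m * qPoch q q j) =
      a ^ m * q ^ (m + 1).choose 2 / qPoch q q j * (q ^ m.choose 2 / qPoch q q m) by
        simp only [div_eq_mul_inv, mul_inv]; ring, ← hs, mul_sum]
    refine sum_congr rfl fun r hr => ?_
    obtain ⟨k, rfl⟩ := Nat.exists_eq_add_of_le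
      (show 2 * r ≤ m by have := mem_range.1 hr; omega)
    rw [show j + (2 * r + k) - 2 * r - j = k by omega, halfInv, if_pos (by omega),
      Nat.add_sub_cancel_left]
    have hx : q ^ (3 * r ^ 2) * (q ^ (2 * r)) ^ k * q ^ (k + 1).choose 2 =
        q ^ (2 * r + k + 1).choose 2 * q ^ (2 * r.choose 2) := by
      rw [← pow_mul, ← pow_add, ← pow_add, ← pow_add]
      congr 1
      have h6 : (2 * r + k + 1).choose 2 = r.choose 2 + r.choose 2 + r * r + (k + 1).choose 2 +
          2 * r * (k + 1) := by
        rw [add_assoc, choose_two_add, two_mul r, choose_two_add]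
      have := two_mul_choose_two r
      rw [h6]
      linear_combination 2 * this.symm
    rw [mul_pow, pow_add a]
    simp only [div_eq_mul_inv, mul_inv]
    linear_combination ((-1) ^ r * a ^ (2 * r) * a ^ k * (qPoch (q ^ 2) (q ^ 2) r)⁻¹ *
      (qPoch q q j)⁻¹ * (qPoch q q k)⁻¹) * hx
  rw [key]
  generalize ∑ r ∈ range (n + 1), a ^ r * q ^ (r ^ 2) / (qPoch q q r * qPoch q q (n - r)) = S
  generalize qPoch (a * q) q n = A at *
  generalize qPoch (-(a * q)) q n = B at *
  generalize qPoch (a ^ 2 * q) (q ^ 2) n = C at *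
  field_simp

/-- The same collapse, now for the dual doubling of the pair (1,2,2); the sum over r is the dual
doubling sum at a = 0. -/
theorem baileyBeta_double_three (a q : K) (n : ℕ) (hq : qPoch q q n ≠ 0)
    (ha : qPoch (a ^ 2 * q) q (2 * n) ≠ 0) :
    baileyBeta (a ^ 2) q (dilate 2 fun s => a ^ s * q ^ (s ^ 2) * unitAlpha a q s) n =
      qPoch (a * q) q n / qPoch (a ^ 2 * q) q (2 * n) *
        ∑ r ∈ range (n + 1), a ^ r * q ^ (n * r) / (qPoch q q r * qPoch q q (n - r)) := by
  rw [baileyBeta_double_dual (a ^ 2) q _ n hq ha]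
  have hf := ha
  rw [qPoch_full_factor] at hf ⊢
  have h1 := left_ne_zero_of_mul hf
  have h2 := left_ne_zero_of_mul (right_ne_zero_of_mul hf)
  have h3 := right_ne_zero_of_mul (right_ne_zero_of_mul hf)
  have key : ∑ r ∈ range (n / 2 + 1),
      baileyBeta (a ^ 2) (q ^ 2) (fun s => a ^ s * q ^ (s ^ 2) * unitAlpha a q s) r *
        q ^ (n - 2 * r).choose 2 / qPoch q q (n - 2 * r) =
      1 / qPoch (-(a * q)) q n *
        ∑ r ∈ range (n + 1), a ^ r * q ^ (n * r) / (qPoch q q r * qPoch q q (n - r)) := by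
    rw [one_div, ← div_eq_inv_mul, eq_div_iff h3]
    have hterm : ∀ r ∈ range (n / 2 + 1),
        baileyBeta (a ^ 2) (q ^ 2) (fun s => a ^ s * q ^ (s ^ 2) * unitAlpha a q s) r *
          q ^ (n - 2 * r).choose 2 / qPoch q q (n - 2 * r) * qPoch (-(a * q)) q n =
        ∑ j ∈ range (n - 2 * r + 1), q ^ (n - 2 * r).choose 2 / qPoch (q ^ 2) (q ^ 2) r *
          ((a * q ^ (2 * r)) ^ j * q ^ (j + 1).choose 2 /
            (qPoch q q (n - 2 * r - j) * qPoch q q j)) := by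
      intro r hr
      have hr' := mem_range.1 hr
      rw [← mul_sum, qBinomial_sum (a * q ^ (2 * r)) q (n - 2 * r)
        (qPoch_ne_zero_of_le hq (by omega)), baileyBeta_one_two_two a q r
        (qPoch_pow_self_ne_zero two_pos hq (by omega))
        (qPoch_pow_ne_zero two_pos ha (by omega))]
      have h4 : qPoch (-(a * q)) q n = qPoch (-(a * q)) q (2 * r) *
          qPoch (-(a * q ^ (2 * r) * q)) q (n - 2 * r) := by
        rw [show n = 2 * r + (n - 2 * r) by omega, qPoch_add, Nat.add_sub_cancel_left]
        congr 2; ring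
      have h5 := qPoch_ne_zero_of_le h3 (show 2 * r ≤ n by omega)
      rw [h4]
      generalize qPoch (-(a * q)) q (2 * r) = A at *
      field_simp
    rw [sum_mul, sum_congr rfl hterm, sum_triangle_comm n fun r j =>
      q ^ (n - 2 * r).choose 2 / qPoch (q ^ 2) (q ^ 2) r *
          ((a * q ^ (2 * r)) ^ j * q ^ (j + 1).choose 2 /
            (qPoch q q (n - 2 * r - j) * qPoch q q j))]
    refine sum_congr rfl fun j hj => ?_
    obtain ⟨m, rfl⟩ := Nat.exists_eq_add_of_le (Nat.lt_succ_iff.1 (mem_range.1 hj))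
    rw [Nat.add_sub_cancel_left]
    have hs := doubling_sum_dual_aux q m 0 (qPoch_ne_zero_of_le hq (by omega)) (by simp)
      (m / 2 + 1) (by omega)
    simp only [zero_mul, qPoch_zero_left, mul_one] at hs
    rw [show a ^ j * q ^ ((j + m) * j) / (qPoch q q j * qPoch q q m) =
      a ^ j * q ^ ((j + m) * j) / qPoch q q j * (1 / qPoch q q m) by
        simp only [div_eq_mul_inv, mul_inv]; ring, ← hs, mul_sum]
    refine sum_congr rfl fun r hr => ?_
    obtain ⟨k, rfl⟩ := Nat.exists_eq_add_of_le
      (show 2 * r ≤ m by have := mem_range.1 hr; omega)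
    rw [show j + (2 * r + k) - 2 * r - j = k by omega, halfInvDual, if_pos (by omega),
      Nat.add_sub_cancel_left, show j + (2 * r + k) - 2 * r = j + k by omega]
    have hx : q ^ (j + k).choose 2 * (q ^ (2 * r)) ^ j * q ^ (j + 1).choose 2 =
        q ^ ((j + (2 * r + k)) * j) * q ^ k.choose 2 := by
      rw [← pow_mul, ← pow_add, ← pow_add, ← pow_add]
      congr 1
      rw [choose_two_add, Nat.choose_succ_succ' j 1, Nat.choose_one_right]
      have := two_mul_choose_two j
      linear_combination this
    rw [mul_pow]
    simp only [div_eq_mul_inv, mul_inv]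
    linear_combination (a ^ j * (qPoch (q ^ 2) (q ^ 2) r)⁻¹ *
      (qPoch q q j)⁻¹ * (qPoch q q k)⁻¹) * hx
  rw [key]
  generalize ∑ r ∈ range (n + 1), a ^ r * q ^ (n * r) / (qPoch q q r * qPoch q q (n - r)) = S
  generalize qPoch (a * q) q n = A at *
  generalize qPoch (-(a * q)) q n = B at *
  generalize qPoch (a ^ 2 * q) (q ^ 2) n = C at *
  field_simp

theorem smpBeta_two_two_three (a q : K) (n : ℕ) (h : BetaDefined 2 a q n) :
    smpBeta 2 2 3 a q n = qPoch (a * q ^ 2) (q ^ 2) n / qPoch (a ^ 2 * q ^ 2) (q ^ 2) (2 * n) *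
      ∑ r ∈ range (n + 1),
        a ^ r * q ^ (2 * n * r) / (qPoch (q ^ 2) (q ^ 2) r * qPoch (q ^ 2) (q ^ 2) (n - r)) := by
  obtain ⟨hq, ha⟩ := h
  rw [smpBeta, smpAlpha_eq_dilate 2 2 1 a q]
  convert baileyBeta_double_three a (q ^ 2) n hq ha using 1
  · congr 2; funext r; ring
  · simp only [← pow_mul, mul_assoc]

theorem smpBeta_two_two_four (a q : K) (hq0 : q ≠ 0) (n : ℕ) (h : BetaDefined 2 a q n) :
    smpBeta 2 2 4 a q n = qPoch (a * q ^ 2) (q ^ 2) n / qPoch (a ^ 2 * q ^ 2) (q ^ 2) (2 * n) *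
      ∑ r ∈ range (n + 1),
        a ^ r * q ^ (2 * r ^ 2) / (qPoch (q ^ 2) (q ^ 2) r * qPoch (q ^ 2) (q ^ 2) (n - r)) := by
  obtain ⟨hq, ha⟩ := h
  rw [smpBeta, smpAlpha_eq_dilate 2 2 2 a q]
  convert baileyBeta_double_four a (q ^ 2) (pow_ne_zero 2 hq0) n hq ha using 1
  · congr 2; funext r; ring
  · simp only [← pow_mul]

end BinomialParts

/-! ### The pair (3,1,4) and the formulas with d = 3. -/

section Tripling

variable {K : Type*} [Field K]

/-- The difference whose sum over `r` gives the first-order recurrence of `baileyBeta_three_one_four`;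
its partial sums are given by `tripling_partial_sum`. -/
def triplingTerm (a q : K) (n r : ℕ) : K :=
  a ^ r * q ^ (3 * r ^ 2) * unitAlpha a (q ^ 3) r /
      (qPoch q q (n + 1 - 3 * r) * qPoch (a * q) q (n + 1 + 3 * r)) *
    ((1 - a * q ^ (2 * n)) * (1 - a * q ^ (2 * n + 1)) * (1 - q ^ (n + 1)) -
      (1 - a * q ^ (3 * n)) * (1 - q ^ (n + 1 - 3 * r)) * (1 - a * q ^ (n + 1 + 3 * r)))

/-- The closed form carries the factor (q²-q^m)(q-q^m)(1-q^m) with m = n+1-3M. It vanishes for m =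
0, 1, 2, that is, exactly at the end of the summation range. -/
theorem tripling_partial_sum (a q : K) (hq0 : q ≠ 0) (n : ℕ) (hq : qPoch q q (n + 1) ≠ 0)
    (ha : qPoch (a * q) q (2 * (n + 1)) ≠ 0) (M : ℕ) : ∀ m, 3 * M + m = n + 1 →
    ∑ r ∈ range (M + 1), triplingTerm a q n r =
      -(q ^ m * (q ^ 2 - q ^ m) * (q - q ^ m) * (1 - q ^ m)) / q ^ 6 *
        ((-1) ^ (M + 1) * q ^ (3 * (M + 1).choose 2) * a ^ (M + 1) * q ^ (3 * (M + 1) ^ 2) *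
          qPoch (a * q ^ 3) (q ^ 3) M / qPoch (q ^ 3) (q ^ 3) M) /
        (qPoch q q m * qPoch (a * q) q (n + 1 + 3 * M)) := by
  induction M with
  | zero =>
    intro m hm
    obtain rfl : m = n + 1 := by omega
    rw [sum_range_one, triplingTerm, unitAlpha_zero]
    simp only [mul_zero, Nat.sub_zero, add_zero, qPoch_zero, pow_zero, zero_add, Nat.choose_succ_self,
      zero_pow two_ne_zero, one_pow, mul_one, pow_one, div_one]
    have f := qPoch_ne_zero_of_le ha (show n + 1 ≤ 2 * (n + 1) by omega)
    generalize qPoch (a * q) q (n + 1) = A at *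
    rw [mul_comm 2 n, mul_comm 3 n, pow_succ q (n * 2), pow_mul, pow_mul, pow_succ q n]
    generalize q ^ n = y
    field_simp
    ring
  | succ M ih =>
    intro m hm
    rw [sum_range_succ, ih (m + 3) (by omega), triplingTerm,
      unitAlpha_succ a (q ^ 3) M (qPoch_pow_ne_zero three_pos ha (by omega))
        (qPoch_pow_self_ne_zero three_pos hq (by omega))]
    have f1 : qPoch q q (m + 3) ≠ 0 := qPoch_ne_zero_of_le hq (by omega)
    have f2 : qPoch (a * q) q (n + 1 + 3 * M + 3) ≠ 0 := qPoch_ne_zero_of_le ha (by omega)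
    have f3 : qPoch (q ^ 3) (q ^ 3) (M + 1) ≠ 0 := qPoch_pow_self_ne_zero three_pos hq (by omega)
    rw [show n + 1 - 3 * (M + 1) = m by omega,
      show n + 1 + 3 * (M + 1) = n + 1 + 3 * M + 3 by omega, qPoch_succ (a * q ^ 3)]
    simp only [qPoch_succ _ _ (m + 2), qPoch_succ _ _ (m + 1), qPoch_succ _ _ m,
      qPoch_succ _ _ (n + 1 + 3 * M + 2), qPoch_succ _ _ (n + 1 + 3 * M + 1),
      qPoch_succ _ _ (n + 1 + 3 * M), qPoch_succ (q ^ 3) (q ^ 3) M] at f1 f2 f3 ⊢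
    obtain rfl : n = 3 * M + m + 2 := by omega
    have hX : (q ^ 3) ^ M = q ^ (3 * M) := (pow_mul q 3 M).symm
    rw [show (q ^ 3) ^ (M + 1).choose 2 = q ^ (3 * (M + 1).choose 2) from (pow_mul _ _ _).symm,
      Nat.choose_succ_succ' (M + 1) 1, Nat.choose_one_right,
      show q ^ (3 * (M + 1 + (M + 1).choose 2)) = q ^ 3 * q ^ (3 * M) * q ^ (3 * (M + 1).choose 2) by
        ring,
      show q ^ (3 * (M + 1 + 1) ^ 2) = q ^ (3 * (M + 1) ^ 2) * (q ^ 9 * (q ^ (3 * M)) ^ 2) by ring,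
      show q ^ (m + 3) * (q ^ 2 - q ^ (m + 3)) * (q - q ^ (m + 3)) * (1 - q ^ (m + 3)) =
        q ^ 6 * q ^ m * (1 - q * q ^ m) * (1 - q * q ^ (m + 1)) * (1 - q * q ^ (m + 2)) by ring,
      show (q ^ 3) ^ (2 * (M + 1)) = q ^ 6 * (q ^ (3 * M)) ^ 2 by ring, hX,
      pow_succ (-1 : K) (M + 1), pow_succ a (M + 1),
      show q ^ (2 * (3 * M + m + 2)) = q ^ 4 * (q ^ (3 * M)) ^ 2 * (q ^ m) ^ 2 by ring,
      show q ^ (2 * (3 * M + m + 2) + 1) = q ^ 5 * (q ^ (3 * M)) ^ 2 * (q ^ m) ^ 2 by ring,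
      show q ^ (3 * M + m + 2 + 1) = q ^ 3 * q ^ (3 * M) * q ^ m by ring,
      show q ^ (3 * (3 * M + m + 2)) = q ^ 6 * (q ^ (3 * M)) ^ 3 * (q ^ m) ^ 3 by ring,
      show q ^ (3 * M + m + 2 + 1 + 3 * M + 3) = q ^ 6 * (q ^ (3 * M)) ^ 2 * q ^ m by ring]
    rw [hX] at f3
    generalize q ^ (3 * (M + 1) ^ 2) = C1
    generalize q ^ (3 * (M + 1).choose 2) = C2
    generalize (-1 : K) ^ (M + 1) = C3
    generalize a ^ (M + 1) = C4
    generalize qPoch (a * q ^ 3) (q ^ 3) M = C5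
    obtain ⟨u, hu⟩ : ∃ u, u = 1 - q ^ 3 * q ^ (3 * M) := ⟨_, rfl⟩
    obtain ⟨v1, hv1⟩ : ∃ u, u = 1 - a * q * q ^ (3 * M + m + 2 + 1 + 3 * M) := ⟨_, rfl⟩
    obtain ⟨v2, hv2⟩ : ∃ u, u = 1 - a * q * q ^ (3 * M + m + 2 + 1 + 3 * M + 1) := ⟨_, rfl⟩
    obtain ⟨v3, hv3⟩ : ∃ u, u = 1 - a * q * q ^ (3 * M + m + 2 + 1 + 3 * M + 2) := ⟨_, rfl⟩
    rw [← hu] at f3 ⊢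
    rw [← hv1, ← hv2, ← hv3] at f2 ⊢
    generalize 1 - q * q ^ m = w1 at *
    generalize 1 - q * q ^ (m + 1) = w2 at *
    generalize 1 - q * q ^ (m + 2) = w3 at *
    simp only [mul_ne_zero_iff] at f1 f2 f3
    obtain ⟨⟨⟨f11, f12⟩, f13⟩, f14⟩ := f1
    obtain ⟨⟨⟨f21, f22⟩, f23⟩, f24⟩ := f2
    obtain ⟨f31, f32⟩ := f3
    generalize qPoch (a * q) q (3 * M + m + 2 + 1 + 3 * M) = P at *
    have hv1' : v1 = 1 - a * q ^ 4 * (q ^ (3 * M)) ^ 2 * q ^ m := by rw [hv1]; ring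
    have hv2' : v2 = 1 - a * q ^ 5 * (q ^ (3 * M)) ^ 2 * q ^ m := by rw [hv2]; ring
    have hv3' : v3 = 1 - a * q ^ 6 * (q ^ (3 * M)) ^ 2 * q ^ m := by rw [hv3]; ring
    clear hv1 hv2 hv3 ih hm hq ha
    generalize q ^ m = z at *
    generalize q ^ (3 * M) = X at *
    field_simp
    rw [hv1', hv2', hv3', hu]
    ring

/-- The pair with `(d,e,k) = (3,1,4)`. -/
theorem baileyBeta_three_one_four (a q : K) (hq0 : q ≠ 0) (ha1 : a ≠ 1) (n : ℕ) :
    qPoch q q n ≠ 0 → qPoch (a * q) q (2 * n) ≠ 0 →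
    baileyBeta a q (dilate 3 fun r => a ^ r * q ^ (3 * r ^ 2) * unitAlpha a (q ^ 3) r) n =
      qPoch a (q ^ 3) n / (qPoch a q (2 * n) * qPoch q q n) := by
  induction n with
  | zero =>
    intro _ _
    simp [baileyBeta, dilate, unitAlpha_zero]
  | succ n ih =>
    intro hq ha
    have ih' := ih (qPoch_ne_zero_of_le hq (by omega)) (qPoch_ne_zero_of_le ha (by omega))
    have e0 : 1 - q ^ (n + 1) ≠ 0 := by
      rw [pow_succ']; exact qPoch_ne_zero_iff.1 hq n (by omega)
    have e1 : 1 - a * q ^ (2 * n + 1) ≠ 0 := by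
      have := qPoch_ne_zero_iff.1 ha (2 * n) (by omega)
      rwa [mul_assoc, ← pow_succ'] at this
    -- For n = 0 this factor is 1-a, which does not occur in (aq;q)_{2n+2}; here a ≠ 1 enters.
    have e2 : 1 - a * q ^ (2 * n) ≠ 0 := by
      rcases n with _ | n
      · simpa [sub_eq_zero] using ha1.symm
      · have := qPoch_ne_zero_iff.1 ha (2 * n + 1) (by omega)
        rwa [mul_assoc, ← pow_succ'] at this
    have key := tripling_partial_sum a q hq0 n hq ha ((n + 1) / 3) ((n + 1) % 3)
      (Nat.div_add_mod _ _)
    have hz : q ^ ((n + 1) % 3) * (q ^ 2 - q ^ ((n + 1) % 3)) * (q - q ^ ((n + 1) % 3)) *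
        (1 - q ^ ((n + 1) % 3)) = 0 := by
      have : (n + 1) % 3 < 3 := Nat.mod_lt _ three_pos
      interval_cases (n + 1) % 3 <;> simp
    rw [hz] at key
    simp only [neg_zero, zero_div, zero_mul] at key
    have hsum : ∑ r ∈ range ((n + 1) / 3 + 1), triplingTerm a q n r =
        (1 - a * q ^ (2 * n)) * (1 - a * q ^ (2 * n + 1)) * (1 - q ^ (n + 1)) *
          baileyBeta a q (dilate 3 fun r => a ^ r * q ^ (3 * r ^ 2) * unitAlpha a (q ^ 3) r) (n + 1) -
        (1 - a * q ^ (3 * n)) *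
          baileyBeta a q (dilate 3 fun r => a ^ r * q ^ (3 * r ^ 2) * unitAlpha a (q ^ 3) r) n := by
      rw [baileyBeta_dilate three_pos]
      -- The sum for n is extended to the range of n+1. The only possible new index has 3r = n+1,
      -- where 1-q^{n+1-3r} = 0.
      have hn : baileyBeta a q (dilate 3 fun r => a ^ r * q ^ (3 * r ^ 2) *
          unitAlpha a (q ^ 3) r) n = ∑ r ∈ range ((n + 1) / 3 + 1),
          a ^ r * q ^ (3 * r ^ 2) * unitAlpha a (q ^ 3) r /
            (qPoch q q (n + 1 - 3 * r) * qPoch (a * q) q (n + 1 + 3 * r)) *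
          ((1 - q ^ (n + 1 - 3 * r)) * (1 - a * q ^ (n + 1 + 3 * r))) := by
        rw [baileyBeta_dilate three_pos]
        symm
        have hsub : range (n / 3 + 1) ⊆ range ((n + 1) / 3 + 1) := by
          intro x; simp only [mem_range]; omega
        rw [← sum_subset hsub]
        · refine sum_congr rfl fun r hr => ?_
          obtain ⟨k, hk⟩ := Nat.exists_eq_add_of_le
            (show 3 * r ≤ n by have := mem_range.1 hr; omega)
          rw [show n + 1 - 3 * r = k + 1 by omega, show n - 3 * r = k by omega,
            show n + 1 + 3 * r = n + 3 * r + 1 by ring, qPoch_succ, qPoch_succ,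
            pow_succ' q k, pow_succ' q (n + 3 * r), ← mul_assoc a q]
          have g1 : 1 - q * q ^ k ≠ 0 := qPoch_ne_zero_iff.1 hq k (by omega)
          have g2 : 1 - a * q * q ^ (n + 3 * r) ≠ 0 :=
            qPoch_ne_zero_iff.1 ha (n + 3 * r) (by omega)
          rw [mul_mul_mul_comm, ← div_div, div_mul_cancel₀ _ (mul_ne_zero g1 g2)]
        · intro r hr hr'
          simp only [mem_range] at hr hr'
          rw [show n + 1 - 3 * r = 0 by omega]
          simp
      rw [hn, mul_sum, mul_sum, ← sum_sub_distrib]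
      refine sum_congr rfl fun r _ => ?_
      rw [triplingTerm]
      ring
    rw [hsum, ih', sub_eq_zero] at key
    rw [Nat.mul_succ, qPoch_succ a q (2 * n + 1), qPoch_succ a q (2 * n), qPoch_succ a (q ^ 3),
      qPoch_succ q q n, ← pow_succ' q n, ← pow_mul]
    apply mul_left_cancel₀ (mul_ne_zero (mul_ne_zero e2 e1) e0)
    rw [key]
    generalize 1 - a * q ^ (2 * n) = w1 at *
    generalize 1 - a * q ^ (2 * n + 1) = w2 at *
    generalize 1 - q ^ (n + 1) = w3 at *
    field_simp

theorem smpBeta_three_two_seven (a q : K) (hq0 : q ≠ 0) (n : ℕ) (h : BetaDefined 2 a q n)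
    (ha1 : a ≠ 1) :
    smpBeta 3 2 7 a q n = 1 / qPoch (-(a * q)) q (2 * n) * ∑ r ∈ range (n + 1),
      a ^ r * q ^ (r ^ 2) * qPoch a (q ^ 3) r /
        (qPoch a q (2 * r) * qPoch q q r * qPoch (q ^ 2) (q ^ 2) (n - r)) := by
  obtain ⟨hq, ha⟩ := h
  rw [smpBeta, smpAlpha_eq_dilate 3 2 4 a q]
  have := baileyBeta_sq a q
    (dilate 3 fun r => a ^ r * q ^ (3 * r ^ 2) * unitAlpha a (q ^ 3) r) n hq ha
  rw [mul_dilate] at this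
  convert this using 1
  · congr 2; funext r; ring
  · congr 1
    refine sum_congr rfl fun m hm => ?_
    have hm' := mem_range.1 hm
    rw [baileyBeta_three_one_four a q hq0 ha1 m
      (qPoch_ne_zero_of_le (qPoch_ne_zero_of_pow hq rfl) (by omega))
      (qPoch_ne_zero_of_le (qPoch_ne_zero_of_pow ha (mul_pow a q 2)) (by omega))]
    simp only [div_eq_mul_inv, mul_inv]
    ring

theorem smpBeta_three_three_seven (a q : K) (hq0 : q ≠ 0) (n : ℕ) (h : BetaDefined 3 a q n)
    (ha1 : a ≠ 1) :
    smpBeta 3 3 7 a q n = 1 / qPoch (a ^ 3 * q ^ 3) (q ^ 3) (2 * n) * ∑ r ∈ range (n + 1),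
      a ^ r * q ^ (r ^ 2) * qPoch a (q ^ 3) r * qPoch (a * q) q (3 * n - r) /
        (qPoch q q r * qPoch a q (2 * r) * qPoch (q ^ 3) (q ^ 3) (n - r)) := by
  obtain ⟨hq, ha⟩ := h
  rw [smpBeta, smpAlpha_eq_dilate 3 3 4 a q]
  have := baileyBeta_cube a q
    (dilate 3 fun r => a ^ r * q ^ (3 * r ^ 2) * unitAlpha a (q ^ 3) r) n hq ha
  rw [mul_dilate] at this
  convert this using 1
  · congr 2; funext r; ring
  · congr 1
    refine sum_congr rfl fun m hm => ?_
    have hm' := mem_range.1 hm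
    rw [baileyBeta_three_one_four a q hq0 ha1 m
      (qPoch_ne_zero_of_le (qPoch_ne_zero_of_pow hq rfl) (by omega))
      (qPoch_ne_zero_of_le (qPoch_ne_zero_of_pow ha (mul_pow a q 3)) (by omega))]
    simp only [div_eq_mul_inv, mul_inv]
    ring

end Tripling

end

theorem mainTheorem7 {K : Type*} [Field K] (a q : K) (hq : q ≠ 0) (n : ℕ) :
    -- (d,e,k) = (1,2,3)
    (BetaDefined 2 a q n →
      smpBeta 1 2 3 a q n =
        1 / qPoch (-q) q n *
          ∑ r ∈ Finset.range (n + 1),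
            a ^ r * q ^ (r ^ 2) / (qPoch q q r * qPoch q q (n - r) * qPoch (-(a * q)) q (n + r))) ∧
    -- (d,e,k) = (1,2,4)
    (BetaDefined 2 a q n →
      smpBeta 1 2 4 a q n =
        ∑ r ∈ Finset.range (n + 1),
          a ^ (2 * r) * q ^ (2 * r ^ 2) /
            (qPoch (-(a * q)) q (2 * r) * qPoch (q ^ 2) (q ^ 2) r * qPoch (q ^ 2) (q ^ 2) (n - r))) ∧
    -- (d,e,k) = (1,3,1)
    (BetaDefined 3 a q n → a ≠ 0 →
      smpBeta 1 3 1 a q n =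
        (-1) ^ n * a ^ (-(n : ℤ)) * q ^ (-((n + 1).choose 2 : ℤ)) * qPoch q q n /
            (qPoch (q ^ 3) (q ^ 3) n * qPoch (a * q) q (2 * n)) *
          ∑ r ∈ Finset.range (n + 1),
            (-1) ^ r * q ^ (((r + 1).choose 2 : ℤ) - n * r) *
                qPoch (a * q) q (n + r) * qPoch (a * q) q (2 * n + r) /
              (qPoch (a ^ 3 * q ^ 3) (q ^ 3) (n + r) * qPoch q q r * qPoch q q (n - r))) ∧
    -- (d,e,k) = (1,3,3)
    (BetaDefined 3 a q n →
      smpBeta 1 3 3 a q n =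
        qPoch q q n / (qPoch (a * q) q (2 * n) * qPoch (q ^ 3) (q ^ 3) n) *
          ∑ r ∈ Finset.range (n + 1),
            a ^ r * q ^ (r ^ 2) * qPoch (a * q) q (2 * n + r) * qPoch (a * q) q (n + r) /
              (qPoch (a ^ 3 * q ^ 3) (q ^ 3) (n + r) * qPoch q q r * qPoch q q (n - r))) ∧
    -- (d,e,k) = (1,3,5)
    (BetaDefined 3 a q n →
      smpBeta 1 3 5 a q n =
        ∑ r ∈ Finset.range (n + 1),
          a ^ (3 * r) * q ^ (3 * r ^ 2) * qPoch (a * q) q (3 * r) /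
            (qPoch (a ^ 3 * q ^ 3) (q ^ 3) (2 * r) * qPoch (q ^ 3) (q ^ 3) r *
              qPoch (q ^ 3) (q ^ 3) (n - r))) ∧
    -- (d,e,k) = (1,4,1)
    (BetaDefined 4 a q n →
      smpBeta 1 4 1 a q n =
        (-1) ^ n * q ^ (2 * n ^ 2) / qPoch (-(a ^ 2 * q ^ 2)) (q ^ 2) (2 * n) *
          ∑ r ∈ Finset.range (n + 1),
            q ^ (3 * (r : ℤ) ^ 2 - 4 * n * r) /
              (qPoch (q ^ 2) (q ^ 2) r * qPoch (-(a * q)) q (2 * r) *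
                qPoch (q ^ 4) (q ^ 4) (n - r))) ∧
    -- (d,e,k) = (1,4,2), for either square root of -1
    (BetaDefined 4 a q n → ∀ i : K, i ^ 2 = -1 →
      smpBeta 1 4 2 a q n =
        i ^ n * q ^ (n ^ 2) * qPoch (i * q) q n * qPoch q q n /
            (qPoch (q ^ 4) (q ^ 4) n * qPoch (i * a * q) q (2 * n) ^ 2) *
          ∑ r ∈ Finset.range (n + 1),
            (-i) ^ r * q ^ ((r : ℤ) ^ 2 - 2 * n * r) * qPoch (i * a * q) q (2 * n + r) /
              (qPoch q q r * qPoch (-(i * a * q)) q (n + r) * qPoch (-(a * q)) q (n + r) *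
                qPoch q q (n - r) * qPoch (i * q) q (n - r))) ∧
    -- (d,e,k) = (1,4,3), for either square root of -1
    (BetaDefined 4 a q n → ∀ i : K, i ^ 2 = -1 →
      smpBeta 1 4 3 a q n =
        qPoch (i * q) q n * qPoch q q n /
            (qPoch (q ^ 4) (q ^ 4) n * qPoch (i * a * q) q (2 * n) ^ 2) *
          ∑ r ∈ Finset.range (n + 1),
            a ^ r * q ^ (r ^ 2) * qPoch (i * a * q) q (2 * n + r) /
              (qPoch q q r * qPoch (-(i * a * q)) q (n + r) * qPoch (-(a * q)) q (n + r) *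
                qPoch q q (n - r) * qPoch (i * q) q (n - r))) ∧
    -- (d,e,k) = (1,4,4)
    (BetaDefined 4 a q n →
      smpBeta 1 4 4 a q n =
        1 / qPoch (-(a ^ 2 * q ^ 2)) (q ^ 2) (2 * n) *
          ∑ r ∈ Finset.range (n + 1),
            a ^ (2 * r) * q ^ (2 * r ^ 2) /
              (qPoch (q ^ 2) (q ^ 2) r * qPoch (-(a * q)) q (2 * r) *
                qPoch (q ^ 4) (q ^ 4) (n - r))) ∧
    -- (d,e,k) = (1,6,3)
    (BetaDefined 6 a q n →
      smpBeta 1 6 3 a q n =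
        1 / qPoch (a ^ 6 * q ^ 6) (q ^ 6) (2 * n) *
          ∑ r ∈ Finset.range (n + 1),
            (-1) ^ r * a ^ (2 * r) * q ^ (3 * r ^ 2) *
                qPoch (a ^ 2 * q ^ 2) (q ^ 2) (3 * n - r) /
              (qPoch (q ^ 2) (q ^ 2) r * qPoch (-(a * q)) q (2 * r) *
                qPoch (q ^ 6) (q ^ 6) (n - r))) ∧
    -- (d,e,k) = (1,6,4)
    (BetaDefined 6 a q n →
      smpBeta 1 6 4 a q n =
        1 / qPoch (a ^ 6 * q ^ 6) (q ^ 6) (2 * n) *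
          ∑ r ∈ Finset.range (n + 1),
            a ^ (2 * r) * q ^ (2 * r ^ 2) * qPoch (a ^ 2 * q ^ 2) (q ^ 2) (3 * n - r) /
              (qPoch (q ^ 2) (q ^ 2) r * qPoch (-(a * q)) q (2 * r) *
                qPoch (q ^ 6) (q ^ 6) (n - r))) ∧
    -- (d,e,k) = (2,1,5)
    (BetaDefined 1 a q n →
      smpBeta 2 1 5 a q n =
        ∑ r ∈ Finset.range (n + 1),
          a ^ r * q ^ (r ^ 2) / (qPoch q q r * qPoch (a * q) (q ^ 2) r * qPoch q q (n - r))) ∧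
    -- (d,e,k) = (2,2,2)
    (BetaDefined 2 a q n →
      smpBeta 2 2 2 a q n =
        (-1) ^ n * q ^ (n ^ 2) / qPoch (-(a * q)) q (2 * n) *
          ∑ r ∈ Finset.range (n + 1),
            (-1) ^ r * q ^ ((3 * (r : ℤ) ^ 2 - r) / 2 - 2 * n * r) /
              (qPoch (a * q) (q ^ 2) r * qPoch q q r * qPoch (q ^ 2) (q ^ 2) (n - r))) ∧
    -- (d,e,k) = (2,2,3)
    (BetaDefined 2 a q n →
      smpBeta 2 2 3 a q n =
        qPoch (a * q ^ 2) (q ^ 2) n / qPoch (a ^ 2 * q ^ 2) (q ^ 2) (2 * n) *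
          ∑ r ∈ Finset.range (n + 1),
            a ^ r * q ^ (2 * n * r) / (qPoch (q ^ 2) (q ^ 2) r * qPoch (q ^ 2) (q ^ 2) (n - r))) ∧
    -- (d,e,k) = (2,2,4)
    (BetaDefined 2 a q n →
      smpBeta 2 2 4 a q n =
        qPoch (a * q ^ 2) (q ^ 2) n / qPoch (a ^ 2 * q ^ 2) (q ^ 2) (2 * n) *
          ∑ r ∈ Finset.range (n + 1),
            a ^ r * q ^ (2 * r ^ 2) / (qPoch (q ^ 2) (q ^ 2) r * qPoch (q ^ 2) (q ^ 2) (n - r))) ∧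
    -- (d,e,k) = (2,2,5)
    (BetaDefined 2 a q n →
      smpBeta 2 2 5 a q n =
        1 / qPoch (-(a * q)) q (2 * n) *
          ∑ r ∈ Finset.range (n + 1),
            a ^ r * q ^ (r ^ 2) /
              (qPoch q q r * qPoch (a * q) (q ^ 2) r * qPoch (q ^ 2) (q ^ 2) (n - r))) ∧
    -- (d,e,k) = (3,2,7)
    (BetaDefined 2 a q n → a ≠ 1 →
      smpBeta 3 2 7 a q n =
        1 / qPoch (-(a * q)) q (2 * n) *
          ∑ r ∈ Finset.range (n + 1),
            a ^ r * q ^ (r ^ 2) * qPoch a (q ^ 3) r /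
              (qPoch a q (2 * r) * qPoch q q r * qPoch (q ^ 2) (q ^ 2) (n - r))) ∧
    -- (d,e,k) = (3,3,7)
    (BetaDefined 3 a q n → a ≠ 1 →
      smpBeta 3 3 7 a q n =
        1 / qPoch (a ^ 3 * q ^ 3) (q ^ 3) (2 * n) *
          ∑ r ∈ Finset.range (n + 1),
            a ^ r * q ^ (r ^ 2) * qPoch a (q ^ 3) r * qPoch (a * q) q (3 * n - r) /
              (qPoch q q r * qPoch a q (2 * r) * qPoch (q ^ 3) (q ^ 3) (n - r))) ∧
    -- (d,e,k) = (4,1,7)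
    (BetaDefined 1 a q n →
      smpBeta 4 1 7 a q n =
        1 / qPoch (a * q) (q ^ 2) n *
          ∑ r ∈ Finset.range (n / 2 + 1),
            a ^ r * q ^ (2 * r ^ 2) /
              (qPoch (q ^ 2) (q ^ 2) r * qPoch (a * q ^ 2) (q ^ 4) r * qPoch q q (n - 2 * r))) := by
  exact ⟨smpBeta_one_two_three a q n, smpBeta_one_two_four a q n,
    fun h ha0 => smpBeta_one_three_one a q hq n h ha0, smpBeta_one_three_three a q n,
    smpBeta_one_three_five a q n, smpBeta_one_four_one a q hq n,
    fun h _ hi => smpBeta_one_four_two a q hq n h hi,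
    fun h _ hi => smpBeta_one_four_three a q n h hi, smpBeta_one_four_four a q n,
    smpBeta_one_six_three a q hq n, smpBeta_one_six_four a q n, smpBeta_two_one_five a q n,
    smpBeta_two_two_two a q hq n, smpBeta_two_two_three a q n, smpBeta_two_two_four a q hq n,
    smpBeta_two_two_five a q n, fun h ha1 => smpBeta_three_two_seven a q hq n h ha1,
    fun h ha1 => smpBeta_three_three_seven a q hq n h ha1, smpBeta_four_one_seven a q n⟩
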